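/- **Conventions.** Let $\mathscr S$ be the class of compactly generated, locally compact (Hausdorff) groups that are totally disconnected, topologically simple and non-discrete. Let $G \in \mathscr S$. A *locally normal subgroup* of $G$ is a compact subgroup $K \le G$ whose normaliser $N_G(K)$ is open in $G$. Let $\mathcal{LN}(G)$ be the set of commensurability classes of locally normal subgroups of $G$; let $0$ be the class of the trivial subgroup and $\infty$ the class of the compact open subgroups. For $\alpha \in \mathcal{LN}(G)$, choose a representative $K$ of $\alpha$ that is a closed normal subgroup of some compact open subgroup $U$ of $G$, and let $\alpha^\perp \in \mathcal{LN}(G)$ be the class of the centraliser $C_U(K)$ (which depends only on $\alpha$). The *centraliser lattice* of $G$ is $\mathcal{LC}(G) = \{\alpha^\perp \mid \alpha \in \mathcal{LN}(G)\}$. For a topological group $K$, the *unrestricted wreath product* $(\prod_{\mathbf Z} K) \rtimes \mathbf Z$ is the semidirect product in which the generator of $\mathbf Z$ acts by shifting the coordinates; its topology is the product of the product topology on $\prod_{\mathbf Z} K$ and the discrete topology on $\mathbf Z$. **Proposition.** Let $G \in \mathscr S$. Then $\mathcal{LC}(G) \neq \{0, \infty\}$ if and only if there are a non-trivial locally normal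 subgroup $K$ of $G$ and a closed subgroup $H$ of $G$ which is the unrestricted wreath product $(\prod_{\mathbf Z} K) \rtimes \mathbf Z$ of $K$ with $\mathbf Z$; that is, there is an isomorphism of topological groups $(\prod_{\mathbf Z} K) \rtimes \mathbf Z \to H$ whose restriction to the factor $K$ of index $0$ is the inclusion of $K$ into $G$. -/

import Mathlib

open scoped Pointwise Topology

/-- A topological group is compactly generated if it is generated, as an abstract group, by some
compact subset. -/
def IsCompactlyGeneratedGroup (G : Type*) [Group G] [TopologicalSpace G] : Prop :=
  ∃ S : Set G, IsCompact S ∧ Subgroup.closure S = ⊤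

/-- A topological group is topologically simple if it is nontrivial and its only closed normal
subgroups are the trivial subgroup and the whole group. -/
def IsTopologicallySimpleGroup (G : Type*) [Group G] [TopologicalSpace G] : Prop :=
  Nontrivial G ∧ ∀ N : Subgroup G, N.Normal → IsClosed (N : Set G) → N = ⊥ ∨ N = ⊤

/-- A locally normal subgroup is a compact subgroup whose normaliser is open. -/
def IsLocallyNormal {G : Type*} [Group G] [TopologicalSpace G] (K : Subgroup G) : Prop :=
  IsCompact (K : Set G) ∧ IsOpen ((Subgroup.normalizer (K : Set G) : Subgroup G) : Set G)

/-- The type of locally normal subgroups of `G`. -/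
def LocallyNormalSubgroup (G : Type*) [Group G] [TopologicalSpace G] : Type _ :=
  {K : Subgroup G // IsLocallyNormal K}

/-- Commensurability of locally normal subgroups: `K ∩ L` has finite index in both `K` and `L`. -/
instance LocallyNormalSubgroup.setoid (G : Type*) [Group G] [TopologicalSpace G] :
    Setoid (LocallyNormalSubgroup G) where
  r K L := Subgroup.Commensurable K.1 L.1
  iseqv := ⟨fun K => Subgroup.Commensurable.refl K.1, fun h => h.symm, fun h h' => h.trans h'⟩

/-- The underlying set of the structure lattice `LN(G)`: locally normal subgroups modulo
commensurability. -/
def StructureLattice (G : Type*) [Group G] [TopologicalSpace G] : Type _ :=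
  Quotient (LocallyNormalSubgroup.setoid G)

/-- The class in `LN(G)` of a locally normal subgroup. -/
def StructureLattice.mk {G : Type*} [Group G] [TopologicalSpace G] (K : Subgroup G)
    (hK : IsLocallyNormal K) : StructureLattice G :=
  Quotient.mk (LocallyNormalSubgroup.setoid G) ⟨K, hK⟩

section

variable {G : Type*} [Group G] [TopologicalSpace G]

theorem StructureLattice.mk_eq_mk_iff {K L : Subgroup G} (hK : IsLocallyNormal K)
    (hL : IsLocallyNormal L) :
    StructureLattice.mk K hK = StructureLattice.mk L hL ↔ Subgroup.Commensurable K L :=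
  Quotient.eq

theorem isLocallyNormal_bot : IsLocallyNormal (⊥ : Subgroup G) := by
  refine ⟨by simp, ?_⟩
  have h : Subgroup.normalizer ((⊥ : Subgroup G) : Set G) = ⊤ := Subgroup.normalizer_eq_top _
  rw [h]
  exact isOpen_univ

/-- A compact subgroup which is normalised by an open subgroup is locally normal. -/
theorem isLocallyNormal_of_le_normalizer [IsTopologicalGroup G] {K U : Subgroup G}
    (hK : IsCompact (K : Set G)) (hU : IsOpen (U : Set G))
    (h : U ≤ Subgroup.normalizer (K : Set G)) : IsLocallyNormal K :=
  ⟨hK, Subgroup.isOpen_mono h hU⟩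

theorem isLocallyNormal_of_isCompact_of_isOpen [IsTopologicalGroup G] {U : Subgroup G}
    (hc : IsCompact (U : Set G)) (ho : IsOpen (U : Set G)) : IsLocallyNormal U :=
  isLocallyNormal_of_le_normalizer hc ho Subgroup.le_normalizer

/-- For `K` normal in the compact open subgroup `U`, the centraliser `C_U(K)` is locally normal. -/
theorem isLocallyNormal_centralizer_inf [IsTopologicalGroup G] [T2Space G] {K U : Subgroup G}
    (hc : IsCompact (U : Set G)) (ho : IsOpen (U : Set G))
    (h : U ≤ Subgroup.normalizer (K : Set G)) :
    IsLocallyNormal (Subgroup.centralizer (K : Set G) ⊓ U) := by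
  refine isLocallyNormal_of_le_normalizer (U := U) ?_ ho ?_
  · have h1 : IsClosed ((Subgroup.centralizer (K : Set G) : Subgroup G) : Set G) :=
      Set.isClosed_centralizer _
    exact hc.inter_left h1
  · have key : ∀ g ∈ U, ∀ x ∈ Subgroup.centralizer (K : Set G) ⊓ U,
        g * x * g⁻¹ ∈ Subgroup.centralizer (K : Set G) ⊓ U := by
      intro g hg x hx
      refine ⟨?_, U.mul_mem (U.mul_mem hg hx.2) (U.inv_mem hg)⟩
      have hx1 := Subgroup.mem_centralizer_iff.1 hx.1
      refine Subgroup.mem_centralizer_iff.2 fun k hk => ?_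
      have hk' : g⁻¹ * k * g ∈ (K : Set G) := by
        have := (Subgroup.mem_normalizer_iff.1 (h (U.inv_mem hg)) k).1 hk
        simpa using this
      have e := hx1 _ hk'
      calc k * (g * x * g⁻¹) = g * ((g⁻¹ * k * g) * x) * g⁻¹ := by group
        _ = g * (x * (g⁻¹ * k * g)) * g⁻¹ := by rw [e]
        _ = g * x * g⁻¹ * k := by group
    intro g hg
    refine Subgroup.mem_normalizer_iff.2 fun x => ⟨key g hg x, fun hx => ?_⟩
    have := key g⁻¹ (U.inv_mem hg) _ hx
    simpa [mul_assoc] using this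

/-- Any two compact open subgroups are commensurable. -/
theorem commensurable_of_isCompact_of_isOpen [IsTopologicalGroup G] {U V : Subgroup G}
    (hUc : IsCompact (U : Set G)) (hUo : IsOpen (U : Set G))
    (hVc : IsCompact (V : Set G)) (hVo : IsOpen (V : Set G)) : Subgroup.Commensurable U V := by
  have key : ∀ A B : Subgroup G, IsOpen (A : Set G) → IsCompact (B : Set G) →
      A.relIndex B ≠ 0 := by
    intro A B hA hB
    have : CompactSpace B := isCompact_iff_compactSpace.1 hB
    have ho : IsOpen ((A.subgroupOf B : Subgroup B) : Set B) := hA.preimage continuous_subtype_val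
    have : Finite (B ⧸ A.subgroupOf B) := Subgroup.quotient_finite_of_isOpen _ ho
    exact Subgroup.index_ne_zero_of_finite
  exact ⟨key U V hUo hVc, key V U hVo hUc⟩

/-- A totally disconnected locally compact group has a compact open subgroup. -/
theorem exists_isCompact_isOpen_subgroup (G : Type*) [Group G] [TopologicalSpace G]
    [IsTopologicalGroup G] [T2Space G] [LocallyCompactSpace G] [TotallyDisconnectedSpace G] :
    ∃ U : Subgroup G, IsCompact (U : Set G) ∧ IsOpen (U : Set G) := by
  obtain ⟨C, hC, hC1⟩ := exists_compact_mem_nhds (1 : G)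
  obtain ⟨V, hV, hV1, hVC⟩ :=
    (loc_compact_Haus_tot_disc_of_zero_dim (H := G)).mem_nhds_iff.1 hC1
  have hVc : IsCompact V := hC.of_isClosed_subset hV.1 hVC
  obtain ⟨W, hW, hVW⟩ := compact_open_separated_mul_right hVc hV.2 subset_rfl
  have hW' : W ∩ W⁻¹ ∈ 𝓝 (1 : G) := Filter.inter_mem hW (inv_mem_nhds_one G hW)
  set U := Subgroup.closure (W ∩ W⁻¹) with hU
  have hUo : IsOpen (U : Set G) :=
    Subgroup.isOpen_of_mem_nhds U (g := 1) (Filter.mem_of_superset hW' Subgroup.subset_closure)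
  refine ⟨U, hVc.of_isClosed_subset (Subgroup.isClosed_of_isOpen U hUo) ?_, hUo⟩
  intro x hx
  induction hx using Subgroup.closure_induction_right with
  | one => exact hV1
  | mul_right x _ y hy ih => exact hVW (Set.mul_mem_mul ih hy.1)
  | mul_inv_cancel x _ y hy ih => exact hVW (Set.mul_mem_mul ih hy.2)

/-- `0 ∈ LN(G)`, the class of the trivial subgroup. -/
instance StructureLattice.instZero : Zero (StructureLattice G) :=
  ⟨StructureLattice.mk ⊥ isLocallyNormal_bot⟩

end

/-- `∞ ∈ LN(G)`, the class of the compact open subgroups (see `StructureLattice.mk_eq_infty`). -/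
noncomputable def StructureLattice.infty (G : Type*) [Group G] [TopologicalSpace G]
    [IsTopologicalGroup G] [T2Space G] [LocallyCompactSpace G] [TotallyDisconnectedSpace G] :
    StructureLattice G :=
  StructureLattice.mk (exists_isCompact_isOpen_subgroup G).choose
    (isLocallyNormal_of_isCompact_of_isOpen
      (exists_isCompact_isOpen_subgroup G).choose_spec.1
      (exists_isCompact_isOpen_subgroup G).choose_spec.2)

theorem StructureLattice.mk_eq_infty {G : Type*} [Group G] [TopologicalSpace G]
    [IsTopologicalGroup G] [T2Space G] [LocallyCompactSpace G] [TotallyDisconnectedSpace G]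
    {U : Subgroup G} (hc : IsCompact (U : Set G)) (ho : IsOpen (U : Set G)) :
    StructureLattice.mk U (isLocallyNormal_of_isCompact_of_isOpen hc ho) =
      StructureLattice.infty G :=
  (StructureLattice.mk_eq_mk_iff _ _).2 (commensurable_of_isCompact_of_isOpen hc ho
    (exists_isCompact_isOpen_subgroup G).choose_spec.1
    (exists_isCompact_isOpen_subgroup G).choose_spec.2)

/-- `IsPerp α β` says that `β = α^⊥`: the class `α` has a representative `K` which is a (closed)
normal subgroup of some compact open subgroup `U`, and `β` is the class of `C_U(K)`. -/
def StructureLattice.IsPerp {G : Type*} [Group G] [TopologicalSpace G] [IsTopologicalGroup G]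
    [T2Space G] (α β : StructureLattice G) : Prop :=
  ∃ (K U : Subgroup G) (hK : IsLocallyNormal K) (hc : IsCompact (U : Set G))
    (ho : IsOpen (U : Set G)) (_ : K ≤ U) (hn : U ≤ Subgroup.normalizer (K : Set G)),
    α = StructureLattice.mk K hK ∧
      β = StructureLattice.mk (Subgroup.centralizer (K : Set G) ⊓ U)
        (isLocallyNormal_centralizer_inf hc ho hn)

/-- Every `α ∈ LN(G)` has a complement `α^⊥`. -/
theorem StructureLattice.exists_isPerp {G : Type*} [Group G] [TopologicalSpace G]
    [IsTopologicalGroup G] [T2Space G] [LocallyCompactSpace G] [TotallyDisconnectedSpace G]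
    (α : StructureLattice G) : ∃ β, StructureLattice.IsPerp α β := by
  obtain ⟨⟨L, hL⟩, rfl⟩ := Quotient.exists_rep α
  obtain ⟨V, hVc, hVo⟩ := exists_isCompact_isOpen_subgroup G
  set U : Subgroup G := V ⊓ Subgroup.normalizer (L : Set G) with hUdef
  have hUo : IsOpen (U : Set G) := hVo.inter hL.2
  have hUc : IsCompact (U : Set G) :=
    hVc.of_isClosed_subset (Subgroup.isClosed_of_isOpen U hUo) fun x hx => hx.1
  have hn : U ≤ Subgroup.normalizer ((L ⊓ U : Subgroup G) : Set G) := by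
    have key : ∀ g ∈ U, ∀ x ∈ L ⊓ U, g * x * g⁻¹ ∈ L ⊓ U := fun g hg x hx =>
      ⟨(Subgroup.mem_normalizer_iff.1 hg.2 x).1 hx.1,
        U.mul_mem (U.mul_mem hg hx.2) (U.inv_mem hg)⟩
    intro g hg
    refine Subgroup.mem_normalizer_iff.2 fun x => ⟨key g hg x, fun hx => ?_⟩
    have := key g⁻¹ (U.inv_mem hg) _ hx
    simpa [mul_assoc] using this
  have hLU : IsLocallyNormal (L ⊓ U) := isLocallyNormal_of_le_normalizer
    (hL.1.inter_right (Subgroup.isClosed_of_isOpen U hUo)) hUo hn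
  refine ⟨_, L ⊓ U, U, hLU, hUc, hUo, inf_le_right, hn, ?_, rfl⟩
  refine (StructureLattice.mk_eq_mk_iff hL hLU).2 ⟨?_, ?_⟩
  · rw [Subgroup.relIndex_eq_one.2 inf_le_left]
    exact one_ne_zero
  · rw [Subgroup.inf_relIndex_left]
    have : CompactSpace L := isCompact_iff_compactSpace.1 hL.1
    have ho : IsOpen ((U.subgroupOf L : Subgroup L) : Set L) :=
      hUo.preimage continuous_subtype_val
    have : Finite (L ⧸ U.subgroupOf L) := Subgroup.quotient_finite_of_isOpen _ ho
    exact Subgroup.index_ne_zero_of_finite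

/-- The underlying set `LC(G) = {α^⊥ | α ∈ LN(G)}` of the centraliser lattice. -/
def centraliserLattice (G : Type*) [Group G] [TopologicalSpace G] [IsTopologicalGroup G]
    [T2Space G] : Set (StructureLattice G) :=
  {β | ∃ α, StructureLattice.IsPerp α β}

/-- The topology of `(∏_Q D) ⋊ Q`: as a space it is the product of `∏_Q D`, with the product
topology, and `Q`. -/
instance RegularWreathProduct.instTopologicalSpace (D Q : Type*) [TopologicalSpace D]
    [TopologicalSpace Q] : TopologicalSpace (RegularWreathProduct D Q) :=
  TopologicalSpace.induced (RegularWreathProduct.equivProd D Q) inferInstance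

/-- The unrestricted wreath product `(∏_ℤ K) ⋊ ℤ`, in which `ℤ` acts by shifting the coordinates;
the group `ℤ` is written multiplicatively and is discrete. -/
abbrev UnrestrictedWreathProductInt (K : Type*) : Type _ :=
  RegularWreathProduct K (Multiplicative ℤ)

/-- The embedding of `K` into `(∏_ℤ K) ⋊ ℤ` as the factor with index `0 ∈ ℤ`. -/
def UnrestrictedWreathProductInt.baseFactor {K : Type*} [Group K] (k : K) :
    UnrestrictedWreathProductInt K :=
  ⟨Pi.mulSingle (Multiplicative.ofAdd (0 : ℤ)) k, 1⟩

/-! Triviality is proved by one mechanism. An element whose conjugates all stay in one compact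
subgroup is trivial, because the closure of its normal closure is a compact normal subgroup
(`eq_one_of_forall_conj_mem`). Compact generation makes this checkable: an open subgroup `U` and a
finite set `F`, taken from the conjugates of any prescribed nontrivial subgroup, generate `G`, so
only conjugation by `U` and `F` needs control (`exists_finite_generating`). This gives a trivial
quasi-centre and, with much more work, the absence of nontrivial abelian locally normal subgroups
(`eq_bot_of_mul_comm`). Disjoint locally normal subgroups then centralise each other locally
(`eventually_commute`).

From the lattice to the wreath product: a nontrivial lattice gives disjoint nontrivial locally
normal subgroups, and simplicity makes the action on the lattice faithful: every `y ≠ 1` moves some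
nontrivial `Γ` off itself (`exists_conj_smul_inf_eq_bot`). Compactness turns faithfulness into
finiteness. Finitely many `Γ` have conjugates strictly below every nontrivial element
(`exists_finite_minorising`), and a pigeonhole argument on a descending chain produces `t` and `L`
with pairwise disjoint translates under the powers of `t` (`exists_wandering`). Disjoint translates
converge to `1` inside a compact open subgroup, so a smaller `K` has all translates in it
(`exists_contracting`). They commute exactly, so infinite products converge and assemble, together
with `t`, into the wreath product; the open normaliser of `K` makes the map injective with closed
image (`exists_wreathProduct`).

Conversely, in a wreath product `K` commutes with a conjugate of itself. Then the local centraliser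
of `K` is neither finite nor open, hence its class is neither `0` nor `∞` (`centraliserLattice_ne`).
-/

/-- The groups of the class `𝒮`: compactly generated, topologically simple and non-discrete. -/
structure IsCompactlyGeneratedSimple (G : Type*) [Group G] [TopologicalSpace G] : Prop where
  gen : IsCompactlyGeneratedGroup G
  simple : IsTopologicallySimpleGroup G
  nondiscrete : ¬ DiscreteTopology G

/-! ### Conjugates of subgroups and small open subgroups -/

section Basics

variable {G : Type*} [Group G]

theorem mem_conj_smul {g x : G} {K : Subgroup G} :
    x ∈ MulAut.conj g • K ↔ g⁻¹ * x * g ∈ K := by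
  rw [Subgroup.mem_pointwise_smul_iff_inv_smul_mem, ← map_inv, MulAut.smul_def, MulAut.conj_apply,
    inv_inv]

theorem conj_mul_smul (g h : G) (K : Subgroup G) :
    MulAut.conj (g * h) • K = MulAut.conj g • MulAut.conj h • K := by
  rw [map_mul, mul_smul]

theorem conj_smul_mem {g x : G} {K : Subgroup G} (hx : x ∈ K) :
    g * x * g⁻¹ ∈ MulAut.conj g • K := by
  rw [mem_conj_smul]; simpa [mul_assoc] using hx

theorem conj_smul_eq_bot_iff {g : G} {K : Subgroup G} : MulAut.conj g • K = ⊥ ↔ K = ⊥ := by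
  constructor
  · intro h
    have := congrArg (fun L => (MulAut.conj g)⁻¹ • L) h
    simpa using this
  · rintro rfl
    exact Subgroup.smul_bot _

theorem conj_smul_eq_self_of_mem_normalizer {g : G} {K : Subgroup G}
    (hg : g ∈ Subgroup.normalizer (K : Set G)) : MulAut.conj g • K = K := by
  ext x
  rw [mem_conj_smul]
  have := Subgroup.mem_normalizer_iff.1 (Subgroup.inv_mem _ hg) x
  simpa using this.symm

/-- If every element of `U` conjugates `K` into itself then `U` normalises `K`. -/
theorem le_normalizer_of_conj_mem {K U : Subgroup G}
    (h : ∀ u ∈ U, ∀ x ∈ K, u * x * u⁻¹ ∈ K) : U ≤ Subgroup.normalizer (K : Set G) := by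
  intro g hg
  refine Subgroup.mem_normalizer_iff.2 fun x => ⟨h g hg x, fun hx => ?_⟩
  have := h g⁻¹ (U.inv_mem hg) _ hx
  simpa [mul_assoc] using this

theorem conj_mem_of_le_normalizer {K U : Subgroup G} (h : U ≤ Subgroup.normalizer (K : Set G))
    {u x : G} (hu : u ∈ U) (hx : x ∈ K) : u * x * u⁻¹ ∈ K :=
  (Subgroup.mem_normalizer_iff.1 (h hu) x).1 hx

theorem conj_smul_le_normalizer {K U : Subgroup G} (h : U ≤ Subgroup.normalizer (K : Set G))
    (g : G) :
    MulAut.conj g • U ≤ Subgroup.normalizer ((MulAut.conj g • K : Subgroup G) : Set G) := by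
  refine le_normalizer_of_conj_mem fun u hu x hx => ?_
  rw [mem_conj_smul] at *
  have := conj_mem_of_le_normalizer h hu hx
  simpa [mul_assoc] using this

variable [TopologicalSpace G] [IsTopologicalGroup G]

theorem isOpen_conj_smul {U : Subgroup G} (hU : IsOpen (U : Set G)) (g : G) :
    IsOpen ((MulAut.conj g • U : Subgroup G) : Set G) := by
  have : ((MulAut.conj g • U : Subgroup G) : Set G) = (fun x => g⁻¹ * x * g) ⁻¹' U := by
    ext x; exact mem_conj_smul
  rw [this]
  exact hU.preimage (by fun_prop)

theorem isCompact_conj_smul {U : Subgroup G} (hU : IsCompact (U : Set G)) (g : G) :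
    IsCompact ((MulAut.conj g • U : Subgroup G) : Set G) := by
  have : ((MulAut.conj g • U : Subgroup G) : Set G) = (fun x => g * x * g⁻¹) '' U := by
    ext x
    refine mem_conj_smul.trans ⟨fun h => ⟨_, h, by group⟩, ?_⟩
    rintro ⟨y, hy, rfl⟩
    simpa [mul_assoc] using hy
  rw [this]
  exact hU.image (by fun_prop)

theorem IsLocallyNormal.conj {K : Subgroup G} (hK : IsLocallyNormal K) (g : G) :
    IsLocallyNormal (MulAut.conj g • K) :=
  isLocallyNormal_of_le_normalizer (isCompact_conj_smul hK.1 g) (isOpen_conj_smul hK.2 g)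
    (conj_smul_le_normalizer le_rfl g)

theorem IsLocallyNormal.inf_of_isClosed {K L : Subgroup G} (hK : IsLocallyNormal K)
    (hL : IsClosed (L : Set G)) (hL' : IsOpen (Subgroup.normalizer (L : Set G) : Set G)) :
    IsLocallyNormal (K ⊓ L) := by
  refine isLocallyNormal_of_le_normalizer (U := Subgroup.normalizer (K : Set G) ⊓
    Subgroup.normalizer (L : Set G)) (hK.1.inter_right hL) (hK.2.inter hL')
    (le_normalizer_of_conj_mem fun u hu x hx => ?_)
  exact ⟨conj_mem_of_le_normalizer le_rfl hu.1 hx.1, conj_mem_of_le_normalizer le_rfl hu.2 hx.2⟩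

theorem IsLocallyNormal.inf [T2Space G] {K L : Subgroup G} (hK : IsLocallyNormal K)
    (hL : IsLocallyNormal L) : IsLocallyNormal (K ⊓ L) :=
  hK.inf_of_isClosed hL.1.isClosed hL.2

theorem IsLocallyNormal.inf_of_isOpen {K O : Subgroup G} (hK : IsLocallyNormal K)
    (hO : IsOpen (O : Set G)) : IsLocallyNormal (K ⊓ O) :=
  hK.inf_of_isClosed (Subgroup.isClosed_of_isOpen _ hO)
    (Subgroup.isOpen_mono Subgroup.le_normalizer hO)

/-- The open subgroups form a neighbourhood basis of `1` in a totally disconnected locally compact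
group. -/
theorem exists_isOpen_subgroup_subset [T2Space G] [LocallyCompactSpace G]
    [TotallyDisconnectedSpace G] {O : Set G} (hO : O ∈ 𝓝 (1 : G)) :
    ∃ U : Subgroup G, IsCompact (U : Set G) ∧ IsOpen (U : Set G) ∧ (U : Set G) ⊆ O := by
  obtain ⟨C, hC1, hCO, hC⟩ := local_compact_nhds hO
  obtain ⟨V, hV, hV1, hVC⟩ :=
    (loc_compact_Haus_tot_disc_of_zero_dim (H := G)).mem_nhds_iff.1 hC1
  have hVc : IsCompact V := hC.of_isClosed_subset hV.1 hVC
  obtain ⟨W, hW, hVW⟩ := compact_open_separated_mul_right hVc hV.2 subset_rfl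
  have hW' : W ∩ W⁻¹ ∈ 𝓝 (1 : G) := Filter.inter_mem hW (inv_mem_nhds_one G hW)
  have hUo : IsOpen (Subgroup.closure (W ∩ W⁻¹) : Set G) :=
    Subgroup.isOpen_of_mem_nhds _ (g := 1) (Filter.mem_of_superset hW' Subgroup.subset_closure)
  have hUV : (Subgroup.closure (W ∩ W⁻¹) : Set G) ⊆ V := by
    intro x hx
    induction hx using Subgroup.closure_induction_right with
    | one => exact hV1
    | mul_right x _ y hy ih => exact hVW (Set.mul_mem_mul ih hy.1)
    | mul_inv_cancel x _ y hy ih => exact hVW (Set.mul_mem_mul ih hy.2)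
  exact ⟨_, hVc.of_isClosed_subset (Subgroup.isClosed_of_isOpen _ hUo) hUV, hUo,
    hUV.trans (hVC.trans hCO)⟩

/-- A tube-lemma argument: conjugation is jointly continuous and sends `1` to `1`, and `C` is
compact. -/
theorem eventually_conj_mem {C O : Set G} (hC : IsCompact C) (hO : O ∈ 𝓝 (1 : G)) :
    ∀ᶠ v in 𝓝 (1 : G), ∀ u ∈ C, u * v * u⁻¹ ∈ O := by
  refine hC.eventually_forall_of_forall_eventually fun u _ => ?_
  have h : Filter.Tendsto (fun z : G × G => z.2 * z.1 * z.2⁻¹) (𝓝 (1, u)) (𝓝 1) := by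
    have : Continuous (fun z : G × G => z.2 * z.1 * z.2⁻¹) := by fun_prop
    simpa using this.tendsto (1, u)
  exact h hO

/-- A compact open subgroup `U` has arbitrarily small open normal subgroups. -/
theorem exists_isOpen_subgroup_conj_invariant [T2Space G] [LocallyCompactSpace G]
    [TotallyDisconnectedSpace G] {U : Subgroup G} (hc : IsCompact (U : Set G))
    (ho : IsOpen (U : Set G)) {O : Set G} (hO : O ∈ 𝓝 (1 : G)) :
    ∃ V : Subgroup G, IsCompact (V : Set G) ∧ IsOpen (V : Set G) ∧ (V : Set G) ⊆ O ∧ V ≤ U ∧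
      U ≤ Subgroup.normalizer (V : Set G) := by
  obtain ⟨W, -, hWo, hWO⟩ := exists_isOpen_subgroup_subset
    (Filter.inter_mem hO (ho.mem_nhds U.one_mem))
  -- The intersection of the `U`-conjugates of `W`; compactness of `U` keeps it open.
  let V : Subgroup G :=
    { carrier := {v | ∀ u ∈ U, u * v * u⁻¹ ∈ W}
      one_mem' := fun u _ => by simp
      mul_mem' := fun {a b} ha hb u hu => by
        have := W.mul_mem (ha u hu) (hb u hu)
        simpa [mul_assoc] using this
      inv_mem' := fun {a} ha u hu => by
        have := W.inv_mem (ha u hu)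
        simpa [mul_assoc] using this }
  have hVW : (V : Set G) ⊆ W := fun v hv => by simpa using hv 1 U.one_mem
  have hVo : IsOpen (V : Set G) := Subgroup.isOpen_of_mem_nhds _ (g := 1)
    (eventually_conj_mem hc (hWo.mem_nhds W.one_mem))
  refine ⟨V, hc.of_isClosed_subset (Subgroup.isClosed_of_isOpen _ hVo)
    fun v hv => (hWO (hVW hv)).2, hVo, fun v hv => (hWO (hVW hv)).1,
    fun v hv => (hWO (hVW hv)).2, le_normalizer_of_conj_mem fun u hu v hv w hw => ?_⟩
  have := hv (w * u) (U.mul_mem hw hu)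
  simpa [mul_assoc] using this

end Basics

/-! ### Consequences of simplicity: bounded conjugacy classes and the quasi-centre -/

section Simple

variable {G : Type*} [Group G] [TopologicalSpace G] [IsTopologicalGroup G]

namespace IsCompactlyGeneratedSimple

/-- A compact open subgroup together with finitely many elements of the conjugates of a nontrivial
subgroup generates the group. -/
theorem exists_finite_generating (hG : IsCompactlyGeneratedSimple G) {K U : Subgroup G}
    (hK : K ≠ ⊥) (hU : IsOpen (U : Set G)) :
    ∃ F : Set G, F.Finite ∧ 1 ∈ F ∧ (∀ f ∈ F, ∃ g : G, f ∈ MulAut.conj g • K) ∧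
      ∀ p : G → Prop, p 1 → (∀ u ∈ U, ∀ g, p g → p (u * g)) → (∀ f ∈ F, ∀ g, p g → p (f * g)) →
        ∀ g, p g := by
  obtain ⟨S, hS, hSG⟩ := hG.gen
  set N := Subgroup.normalClosure (K : Set G) with hN
  have hNtop : N.topologicalClosure = ⊤ := by
    refine (hG.simple.2 _ (Subgroup.is_normal_topologicalClosure N)
      N.isClosed_topologicalClosure).resolve_left fun h => hK ?_
    rw [eq_bot_iff, ← h]
    exact fun x hx => N.le_topologicalClosure (Subgroup.subset_normalClosure hx)
  have hdense : Dense (N : Set G) := by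
    rw [dense_iff_closure_eq]
    have := congrArg (fun H : Subgroup G => (H : Set G)) hNtop
    simpa using this
  -- cover `S` by finitely many cosets `n U`
  have hcov : S ⊆ ⋃ n : N, (fun x => (n : G)⁻¹ * x) ⁻¹' (U : Set G) := by
    intro s _
    obtain ⟨n, hn, hnN⟩ := hdense.inter_open_nonempty ((fun x => x⁻¹ * s) ⁻¹' (U : Set G))
      (hU.preimage (by fun_prop)) ⟨s, by simp⟩
    exact Set.mem_iUnion.2 ⟨⟨n, hnN⟩, hn⟩
  obtain ⟨t, ht⟩ := hS.elim_finite_subcover _ (fun n : N => hU.preimage (by fun_prop)) hcov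
  -- each `n` is a product of finitely many elements of conjugates of `K`
  have hfin : ∀ n ∈ N, ∃ F : Set G, F.Finite ∧ (∀ f ∈ F, ∃ g : G, f ∈ MulAut.conj g • K) ∧
      n ∈ Subgroup.closure F := by
    intro n hn
    induction hn using Subgroup.closure_induction with
    | mem x hx =>
      obtain ⟨k, hk, hkx⟩ := Group.mem_conjugatesOfSet_iff.1 hx
      obtain ⟨c, hc⟩ := isConj_iff.1 hkx
      refine ⟨{x}, Set.finite_singleton _, ?_, Subgroup.subset_closure rfl⟩
      rintro f rfl
      exact ⟨c, hc ▸ conj_smul_mem hk⟩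
    | one => exact ⟨∅, Set.finite_empty, by simp, Subgroup.one_mem _⟩
    | mul x y _ _ hx hy =>
      obtain ⟨F, hF, h1, h2⟩ := hx
      obtain ⟨F', hF', h1', h2'⟩ := hy
      refine ⟨F ∪ F', hF.union hF', fun f hf => hf.elim (h1 f) (h1' f), Subgroup.mul_mem _
        (Subgroup.closure_mono Set.subset_union_left h2)
        (Subgroup.closure_mono Set.subset_union_right h2')⟩
    | inv x _ hx =>
      obtain ⟨F, hF, h1, h2⟩ := hx
      exact ⟨F, hF, h1, Subgroup.inv_mem _ h2⟩
  choose! F hF1 hF2 hF3 using hfin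
  set E : Set G := insert 1 (⋃ n ∈ t, F (n : G)) with hE
  have hEfin : E.Finite := (t.finite_toSet.biUnion fun n _ => hF1 n n.2).insert 1
  have hEK : ∀ f ∈ E, ∃ g : G, f ∈ MulAut.conj g • K := by
    rintro f (rfl | hf)
    · exact ⟨1, Subgroup.one_mem _⟩
    · simp only [Set.mem_iUnion] at hf
      obtain ⟨n, _, hf⟩ := hf
      exact hF2 n n.2 f hf
  have hgen : Subgroup.closure ((U : Set G) ∪ E) = ⊤ := by
    rw [eq_top_iff, ← hSG, Subgroup.closure_le]
    intro s hs
    obtain ⟨n, hn, hsn⟩ := Set.mem_iUnion₂.1 (ht hs)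
    have h1 : (n : G) ∈ Subgroup.closure ((U : Set G) ∪ E) := by
      refine Subgroup.closure_mono ?_ (hF3 n n.2)
      exact fun f hf => Or.inr (Or.inr (Set.mem_iUnion₂.2 ⟨n, hn, hf⟩))
    have h2 : (n : G)⁻¹ * s ∈ Subgroup.closure ((U : Set G) ∪ E) :=
      Subgroup.subset_closure (Or.inl hsn)
    have := Subgroup.mul_mem _ h1 h2
    simpa using this
  -- Symmetrising the finite set removes the inverse case from the induction principle.
  refine ⟨E ∪ E⁻¹, hEfin.union hEfin.inv, Or.inl (Or.inl rfl), ?_, fun p p1 pU pF g => ?_⟩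
  · rintro f (hf | hf)
    · exact hEK f hf
    · obtain ⟨g, hg⟩ := hEK _ hf
      exact ⟨g, by simpa using Subgroup.inv_mem _ hg⟩
  · have hg : g ∈ Subgroup.closure ((U : Set G) ∪ E) := hgen ▸ Subgroup.mem_top g
    induction hg using Subgroup.closure_induction_left with
    | one => exact p1
    | mul_left x hx y _ ih => exact hx.elim (fun h => pU x h y ih) fun h => pF x (Or.inl h) y ih
    | inv_mul_cancel x hx y _ ih =>
      exact hx.elim (fun h => pU _ (U.inv_mem h) y ih) fun h => pF _ (Or.inr (by simpa using h)) y ih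

theorem ne_bot_of_isOpen (hG : IsCompactlyGeneratedSimple G) {O : Subgroup G}
    (hO : IsOpen (O : Set G)) : O ≠ ⊥ := by
  rintro rfl
  exact hG.nondiscrete (discreteTopology_of_isOpen_singleton_one (by simpa using hO))

variable [T2Space G] [LocallyCompactSpace G] [TotallyDisconnectedSpace G]

/-- Otherwise `G` itself is compact, hence profinite, and has a proper open normal subgroup missing
a given `g ≠ 1`. By simplicity that subgroup is trivial, so `G` is discrete. -/
theorem eq_bot_of_isCompact_of_normal (hG : IsCompactlyGeneratedSimple G) {N : Subgroup G}
    (hN : N.Normal) (hc : IsCompact (N : Set G)) : N = ⊥ := by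
  refine (hG.simple.2 N hN hc.isClosed).resolve_right ?_
  rintro rfl
  have := hG.simple.1
  obtain ⟨g, hg⟩ := exists_ne (1 : G)
  obtain ⟨V, -, ho, hV, -, hn⟩ := exists_isOpen_subgroup_conj_invariant (U := (⊤ : Subgroup G)) hc
    isOpen_univ (isOpen_ne.mem_nhds hg.symm)
  have hVn : V.Normal := ⟨fun v hv u => conj_mem_of_le_normalizer hn (Subgroup.mem_top u) hv⟩
  rcases hG.simple.2 V hVn (Subgroup.isClosed_of_isOpen _ ho) with rfl | rfl
  · exact hG.nondiscrete (discreteTopology_of_isOpen_singleton_one (by simpa using ho))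
  · exact hV (Subgroup.mem_top g) rfl

/-- A conjugation invariant subset of a compact subgroup is trivial. -/
theorem eq_one_of_forall_conj_mem (hG : IsCompactlyGeneratedSimple G) {C : Subgroup G}
    (hC : IsCompact (C : Set G)) {x : G} (hx : ∀ g, g * x * g⁻¹ ∈ C) : x = 1 := by
  have h : Subgroup.normalClosure {x} ≤ C := by
    rw [Subgroup.normalClosure, Subgroup.closure_le]
    intro y hy
    obtain ⟨_, rfl, hk⟩ := Group.mem_conjugatesOfSet_iff.1 hy
    obtain ⟨c, rfl⟩ := isConj_iff.1 hk
    exact hx c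
  have h2 : (Subgroup.normalClosure {x}).topologicalClosure = ⊥ := by
    refine hG.eq_bot_of_isCompact_of_normal (Subgroup.is_normal_topologicalClosure _) ?_
    exact hC.of_isClosed_subset (Subgroup.isClosed_topologicalClosure _)
      (Subgroup.topologicalClosure_minimal _ h hC.isClosed)
  have h3 : x ∈ (Subgroup.normalClosure {x}).topologicalClosure :=
    Subgroup.le_topologicalClosure _ (Subgroup.subset_normalClosure rfl)
  rw [h2] at h3
  exact h3

/-- A locally normal subgroup that is locally centralised by each element of the conjugates of a
nontrivial subgroup is discrete. -/
theorem exists_inf_eq_bot_of_eventually_commute (hG : IsCompactlyGeneratedSimple G)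
    {E K : Subgroup G} (hE : IsLocallyNormal E) (hK : K ≠ ⊥)
    (h : ∀ f g : G, f ∈ MulAut.conj g • K → ∀ᶠ x in 𝓝 (1 : G), x ∈ E → f * x = x * f) :
    ∃ W : Subgroup G, IsOpen (W : Set G) ∧ E ⊓ W = ⊥ := by
  obtain ⟨U, hUc, hUo, hUE⟩ := exists_isOpen_subgroup_subset (hE.2.mem_nhds (Subgroup.one_mem _))
  obtain ⟨F, hF, -, hFK, hind⟩ := hG.exists_finite_generating hK hUo
  obtain ⟨W, -, hWo, hW, -, hUW⟩ := exists_isOpen_subgroup_conj_invariant hUc hUo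
    ((Filter.eventually_all_finite hF).2 fun f hf => (hFK f hf).elim fun g hg => h f g hg)
  refine ⟨W, hWo, (Subgroup.eq_bot_iff_forall _).2 fun x hx => ?_⟩
  -- `U` normalises `E ⊓ W` and `F` centralises it elementwise, so conjugating by words in `U` and
  -- `F` never leaves this compact subgroup.
  have hall : ∀ g : G, g * x * g⁻¹ ∈ E ⊓ W := by
    refine hind _ (by simpa using hx) ?_ ?_
    · intro u hu g hg
      have h1 := conj_mem_of_le_normalizer hUE hu hg.1
      have h2 := conj_mem_of_le_normalizer hUW hu hg.2
      exact ⟨by simpa [mul_assoc] using h1, by simpa [mul_assoc] using h2⟩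
    · intro f hf g hg
      have h1 := hW hg.2 f hf hg.1
      have h2 : f * g * x * (f * g)⁻¹ = g * x * g⁻¹ := by
        calc f * g * x * (f * g)⁻¹ = f * (g * x * g⁻¹) * f⁻¹ := by group
          _ = (g * x * g⁻¹) * f * f⁻¹ := by rw [h1]
          _ = _ := by group
      rw [h2]; exact hg
  exact hG.eq_one_of_forall_conj_mem hE.1 fun g => (hall g).1

/-- The quasi-centre is trivial. -/
theorem eq_one_of_isOpen_centralizer (hG : IsCompactlyGeneratedSimple G) {x : G}
    (hx : ∀ᶠ u in 𝓝 (1 : G), u * x = x * u) : x = 1 := by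
  by_contra hx1
  obtain ⟨U, hUc, hUo⟩ := exists_isCompact_isOpen_subgroup G
  obtain ⟨W, hWo, hW⟩ := hG.exists_inf_eq_bot_of_eventually_commute
    (isLocallyNormal_of_isCompact_of_isOpen hUc hUo) (K := Subgroup.zpowers x) (by simpa using hx1)
    fun f g hg => by
      rw [mem_conj_smul] at hg
      obtain ⟨n, hn⟩ := Subgroup.mem_zpowers_iff.1 hg
      have ht : Filter.Tendsto (fun u : G => g⁻¹ * u * g) (𝓝 1) (𝓝 1) := by
        have : Continuous (fun u : G => g⁻¹ * u * g) := by fun_prop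
        simpa using this.tendsto 1
      filter_upwards [ht.eventually hx] with u hu _
      have h1 : Commute (g⁻¹ * u * g) (x ^ n) := Commute.zpow_right hu n
      rw [hn] at h1
      have h2 := congrArg (fun y => g * y * g⁻¹) h1.eq.symm
      simpa [mul_assoc] using h2
  exact hG.ne_bot_of_isOpen (hUo.inter hWo) hW

/-- A nontrivial locally normal subgroup meets every open subgroup nontrivially. -/
theorem eq_bot_of_inf_eq_bot (hG : IsCompactlyGeneratedSimple G) {K O : Subgroup G}
    (hK : IsLocallyNormal K) (hO : IsOpen (O : Set G)) (h : K ⊓ O = ⊥) : K = ⊥ := by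
  rw [Subgroup.eq_bot_iff_forall]
  intro k hk
  refine hG.eq_one_of_isOpen_centralizer ?_
  -- For `u` near `1` the commutator of `u` and `k` lies in both `K` and `O`, so `k` has an open
  -- centraliser.
  have ht : Filter.Tendsto (fun u : G => u * k * u⁻¹ * k⁻¹) (𝓝 1) (𝓝 1) := by
    have : Continuous (fun u : G => u * k * u⁻¹ * k⁻¹) := by fun_prop
    simpa using this.tendsto 1
  filter_upwards [ht.eventually (hO.mem_nhds O.one_mem),
    hK.2.mem_nhds (Subgroup.one_mem _)] with u hu hn
  have h1 : u * k * u⁻¹ * k⁻¹ ∈ K ⊓ O :=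
    ⟨K.mul_mem (conj_mem_of_le_normalizer le_rfl hn hk) (K.inv_mem hk), hu⟩
  rw [h, Subgroup.mem_bot, mul_inv_eq_one, mul_inv_eq_iff_eq_mul] at h1
  exact h1

end IsCompactlyGeneratedSimple

end Simple

/-! ### Absence of abelian locally normal subgroups -/

section Abelian

variable {G : Type*} [Group G]

theorem mul_comm_of_conj_mem {X Y : Subgroup G} (h : X ⊓ Y = ⊥) {x y : G} (hx : x ∈ X)
    (hy : y ∈ Y) (hxy : x * y * x⁻¹ ∈ Y) (hyx : y * x⁻¹ * y⁻¹ ∈ X) : x * y = y * x := by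
  have h1 : x * y * x⁻¹ * y⁻¹ ∈ X ⊓ Y := by
    refine ⟨?_, Y.mul_mem hxy (Y.inv_mem hy)⟩
    have := X.mul_mem hx hyx
    simpa [mul_assoc] using this
  rw [h, Subgroup.mem_bot, mul_inv_eq_one, mul_inv_eq_iff_eq_mul] at h1
  exact h1

/-- Used when `f * x * f⁻¹ = a * x` and `f * y * f⁻¹ = b * y` with correction terms `a`, `b`:
conjugation by `f` then fixes the commutator of `x` and `y`. -/
theorem commutator_mul_mul_eq {a b x y : G} (hab : Commute a b) (hax : Commute a x)
    (hay : Commute a y) (hbx : Commute b x) (hby : Commute b y) :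
    (a * x) * (b * y) * (a * x)⁻¹ * (b * y)⁻¹ = x * y * x⁻¹ * y⁻¹ := by
  have h1 : (a * x) * (b * y) = (a * b) * (x * y) := by
    rw [mul_assoc, ← mul_assoc x, ← hbx.eq]; simp only [mul_assoc]
  have h2 : (b * y) * (a * x) = (a * b) * (y * x) := by
    rw [mul_assoc, ← mul_assoc y, ← hay.eq, hab.eq]; simp only [mul_assoc]
  have hc : Commute (a * b) ((x * y) * (y * x)⁻¹) :=
    (((hax.mul_left hbx).mul_right (hay.mul_left hby))).mul_right
      ((hay.mul_left hby).mul_right (hax.mul_left hbx)).inv_right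
  calc (a * x) * (b * y) * (a * x)⁻¹ * (b * y)⁻¹
      = ((a * x) * (b * y)) * ((b * y) * (a * x))⁻¹ := by group
    _ = (a * b) * ((x * y) * (y * x)⁻¹) * (a * b)⁻¹ := by rw [h1, h2]; group
    _ = (x * y) * (y * x)⁻¹ := by rw [hc.eq]; group
    _ = _ := by group

/-- The elements commuting with the part in `O` of each member of a family of subgroups. -/
def familyCentralizer (𝒜 : Set (Subgroup G)) (O : Subgroup G) : Subgroup G :=
  Subgroup.centralizer {b | b ∈ O ∧ ∃ B ∈ 𝒜, b ∈ B}

theorem mem_familyCentralizer {𝒜 : Set (Subgroup G)} {O : Subgroup G} {x : G} :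
    x ∈ familyCentralizer 𝒜 O ↔ ∀ B ∈ 𝒜, ∀ b ∈ B, b ∈ O → b * x = x * b := by
  rw [familyCentralizer, Subgroup.mem_centralizer_iff]
  exact ⟨fun h B hB b hb hO => h b ⟨hO, B, hB, hb⟩, fun h b ⟨hO, B, hB, hb⟩ => h B hB b hb hO⟩

theorem conj_mem_familyCentralizer {𝒜 : Set (Subgroup G)} {O : Subgroup G} {u x : G}
    (hu : ∀ B ∈ 𝒜, MulAut.conj u⁻¹ • B ∈ 𝒜) (hx : x ∈ familyCentralizer 𝒜 O) :
    u * x * u⁻¹ ∈ familyCentralizer 𝒜 (MulAut.conj u • O) := by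
  rw [mem_familyCentralizer] at *
  intro B hB b hb hbO
  have h1 := hx _ (hu B hB) (u⁻¹ * b * u)
    (by have := conj_smul_mem (g := u⁻¹) hb; simpa using this) (mem_conj_smul.1 hbO)
  have h2 := congrArg (fun y => u * y * u⁻¹) h1
  simpa [mul_assoc] using h2

/-- A finite family `𝒜` of conjugates of `A`, stable under conjugation by `U`, together with a
finite subset `F` of its union that generates the group with `U`. -/
structure GeneratingFamily (A U : Subgroup G) (F : Set G) (𝒜 : Set (Subgroup G)) : Prop where
  finite : F.Finite
  finite_family : 𝒜.Finite
  nonempty : 𝒜.Nonempty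
  conj_mem : ∀ u ∈ U, ∀ B ∈ 𝒜, MulAut.conj u • B ∈ 𝒜
  eq_conj : ∀ B ∈ 𝒜, ∃ g : G, B = MulAut.conj g • A
  mem_family : ∀ f ∈ F, ∃ B ∈ 𝒜, f ∈ B
  induction : ∀ p : G → Prop, p 1 → (∀ u ∈ U, ∀ g, p g → p (u * g)) →
    (∀ f ∈ F, ∀ g, p g → p (f * g)) → ∀ g, p g

namespace GeneratingFamily

variable {A U : Subgroup G} {F : Set G} {𝒜 : Set (Subgroup G)}

theorem mul_comm (h : GeneratingFamily A U F 𝒜) (hab : ∀ x ∈ A, ∀ y ∈ A, x * y = y * x)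
    {B : Subgroup G} (hB : B ∈ 𝒜) {x y : G} (hx : x ∈ B) (hy : y ∈ B) : x * y = y * x := by
  obtain ⟨g, rfl⟩ := h.eq_conj B hB
  have := congrArg (fun z => g * z * g⁻¹) (hab _ (mem_conj_smul.1 hx) _ (mem_conj_smul.1 hy))
  simpa [mul_assoc] using this

theorem conj_mem_familyCentralizer (h : GeneratingFamily A U F 𝒜) {O : Subgroup G}
    (hUO : U ≤ Subgroup.normalizer (O : Set G)) {u x : G} (hu : u ∈ U)
    (hx : x ∈ familyCentralizer 𝒜 O) : u * x * u⁻¹ ∈ familyCentralizer 𝒜 O := by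
  have := _root_.conj_mem_familyCentralizer (h.conj_mem _ (U.inv_mem hu)) hx
  rwa [conj_smul_eq_self_of_mem_normalizer (hUO hu)] at this

end GeneratingFamily

variable [TopologicalSpace G] [IsTopologicalGroup G]

/-- A conjugate depends only on the coset of the open normaliser, and finitely many such cosets
cover `U`. -/
theorem finite_conj_smul {K U : Subgroup G} (hK : IsLocallyNormal K)
    (hU : IsCompact (U : Set G)) : {B | ∃ u ∈ U, B = MulAut.conj u • K}.Finite := by
  have hcov : (U : Set G) ⊆ ⋃ u : U, (fun x => (u : G)⁻¹ * x) ⁻¹'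
      (Subgroup.normalizer (K : Set G) : Set G) := fun u hu =>
    Set.mem_iUnion.2 ⟨⟨u, hu⟩, by simp⟩
  obtain ⟨t, ht⟩ := hU.elim_finite_subcover _ (fun u : U => hK.2.preimage (by fun_prop)) hcov
  refine (t.finite_toSet.image fun u : U => MulAut.conj (u : G) • K).subset ?_
  rintro _ ⟨u, hu, rfl⟩
  obtain ⟨w, hw, hwu⟩ := Set.mem_iUnion₂.1 (ht hu)
  refine ⟨w, hw, ?_⟩
  change MulAut.conj (w : G) • K = _
  rw [← conj_smul_eq_self_of_mem_normalizer hwu, ← conj_mul_smul, mul_inv_cancel_left,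
    conj_smul_eq_self_of_mem_normalizer hwu]

theorem IsCompactlyGeneratedSimple.exists_generatingFamily
    (hG : IsCompactlyGeneratedSimple G) {A U : Subgroup G}
    (hA : IsLocallyNormal A) (hA1 : A ≠ ⊥) (hUc : IsCompact (U : Set G))
    (hUo : IsOpen (U : Set G)) : ∃ F 𝒜, GeneratingFamily A U F 𝒜 := by
  obtain ⟨F, hF, h1F, hFA, hind⟩ := hG.exists_finite_generating hA1 hUo
  choose! γ hγ using hFA
  refine ⟨F, ⋃ f ∈ F, {B | ∃ u ∈ U, B = MulAut.conj u • MulAut.conj (γ f) • A}, hF,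
    hF.biUnion fun f _ => finite_conj_smul (hA.conj _) hUc, ?_, ?_, ?_, ?_, hind⟩
  · exact ⟨_, Set.mem_iUnion₂.2 ⟨1, h1F, 1, U.one_mem, rfl⟩⟩
  · rintro u hu B hB
    obtain ⟨f, hf, w, hw, rfl⟩ := Set.mem_iUnion₂.1 hB
    exact Set.mem_iUnion₂.2 ⟨f, hf, u * w, U.mul_mem hu hw, (conj_mul_smul _ _ _).symm⟩
  · rintro B hB
    obtain ⟨f, hf, w, hw, rfl⟩ := Set.mem_iUnion₂.1 hB
    exact ⟨w * γ f, (conj_mul_smul _ _ _).symm⟩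
  · intro f hf
    refine ⟨MulAut.conj (γ f) • A, Set.mem_iUnion₂.2 ⟨f, hf, 1, U.one_mem, by simp⟩, hγ f hf⟩

theorem GeneratingFamily.isLocallyNormal {A U : Subgroup G} {F : Set G}
    {𝒜 : Set (Subgroup G)} (h : GeneratingFamily A U F 𝒜) (hA : IsLocallyNormal A) {B : Subgroup G}
    (hB : B ∈ 𝒜) : IsLocallyNormal B := by
  obtain ⟨g, rfl⟩ := h.eq_conj B hB
  exact hA.conj g

variable [T2Space G]

theorem isClosed_familyCentralizer (𝒜 : Set (Subgroup G)) (O : Subgroup G) :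
    IsClosed (familyCentralizer 𝒜 O : Set G) := Set.isClosed_centralizer _

variable [LocallyCompactSpace G] [TotallyDisconnectedSpace G]

namespace GeneratingFamily

variable {A U : Subgroup G} {F : Set G} {𝒜 : Set (Subgroup G)}

/-- The commutators of elements of `F` with elements of a small open subgroup are small. -/
theorem exists_small (h : GeneratingFamily A U F 𝒜) (hA : IsLocallyNormal A)
    (hUc : IsCompact (U : Set G)) (hUo : IsOpen (U : Set G)) {O : Set G} (hO : O ∈ 𝓝 (1 : G)) :
    ∃ V : Subgroup G, IsCompact (V : Set G) ∧ IsOpen (V : Set G) ∧ (V : Set G) ⊆ O ∧ V ≤ U ∧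
      U ≤ Subgroup.normalizer (V : Set G) ∧ (∀ f ∈ F, ∀ v ∈ V, f * v * f⁻¹ * v⁻¹ ∈ O) ∧
      ∀ B ∈ 𝒜, V ≤ Subgroup.normalizer (B : Set G) := by
  have h1 : ∀ᶠ v in 𝓝 (1 : G), ∀ f ∈ F, f * v * f⁻¹ * v⁻¹ ∈ O := by
    refine (Filter.eventually_all_finite h.finite).2 fun f _ => ?_
    have ht : Filter.Tendsto (fun v : G => f * v * f⁻¹ * v⁻¹) (𝓝 1) (𝓝 1) := by
      have : Continuous (fun v : G => f * v * f⁻¹ * v⁻¹) := by fun_prop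
      simpa using this.tendsto 1
    exact ht.eventually hO
  have h2 : ∀ᶠ v in 𝓝 (1 : G), ∀ B ∈ 𝒜, v ∈ Subgroup.normalizer (B : Set G) :=
    (Filter.eventually_all_finite h.finite_family).2 fun B hB =>
      (h.isLocallyNormal hA hB).2.mem_nhds (Subgroup.one_mem _)
  obtain ⟨V, hVc, hVo, hV, hVU, hVn⟩ := exists_isOpen_subgroup_conj_invariant hUc hUo
    (Filter.inter_mem hO (Filter.inter_mem h1 h2))
  exact ⟨V, hVc, hVo, fun v hv => (hV hv).1, hVU, hVn, fun f hf v hv => (hV hv).2.1 f hf,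
    fun B hB v hv => (hV hv).2.2 B hB⟩

/-- Locally, the centraliser of a generating family of abelian subgroups is abelian. -/
theorem mul_comm_of_mem_familyCentralizer (h : GeneratingFamily A U F 𝒜)
    (hG : IsCompactlyGeneratedSimple G) (hab : ∀ x ∈ A, ∀ y ∈ A, x * y = y * x)
    {O V : Subgroup G} (hUO : U ≤ Subgroup.normalizer (O : Set G)) (hVc : IsCompact (V : Set G))
    (hUV : U ≤ Subgroup.normalizer (V : Set G))
    (hFV : ∀ f ∈ F, ∀ v ∈ V, f * v * f⁻¹ * v⁻¹ ∈ O)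
    (hV𝒜 : ∀ B ∈ 𝒜, V ≤ Subgroup.normalizer (B : Set G)) {x y : G}
    (hx : x ∈ familyCentralizer 𝒜 O ⊓ V) (hy : y ∈ familyCentralizer 𝒜 O ⊓ V) :
    x * y = y * x := by
  have hcomm : ∀ f ∈ F, ∀ B ∈ 𝒜, f ∈ B → ∀ z ∈ V, f * z * f⁻¹ * z⁻¹ ∈ B := by
    intro f _ B hB hfB z hz
    have := B.mul_mem hfB (conj_mem_of_le_normalizer (hV𝒜 B hB) hz (B.inv_mem hfB))
    simpa [mul_assoc] using this
  have key : ∀ g : G, ∃ x' ∈ familyCentralizer 𝒜 O ⊓ V, ∃ y' ∈ familyCentralizer 𝒜 O ⊓ V,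
      g * (x * y * x⁻¹ * y⁻¹) * g⁻¹ = x' * y' * x'⁻¹ * y'⁻¹ := by
    refine h.induction _ ⟨x, hx, y, hy, by simp⟩ ?_ ?_
    · rintro u hu g ⟨x', hx', y', hy', e⟩
      refine ⟨u * x' * u⁻¹, ⟨h.conj_mem_familyCentralizer hUO hu hx'.1,
        conj_mem_of_le_normalizer hUV hu hx'.2⟩, u * y' * u⁻¹,
        ⟨h.conj_mem_familyCentralizer hUO hu hy'.1, conj_mem_of_le_normalizer hUV hu hy'.2⟩, ?_⟩
      calc _ = u * (g * (x * y * x⁻¹ * y⁻¹) * g⁻¹) * u⁻¹ := by group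
        _ = _ := by rw [e]; group
    -- Conjugation by `f` multiplies `x'` and `y'` by commutators lying in `B` and in `O`. These
    -- commute with each other since `B` is abelian, and with `x'` and `y'` by definition of the
    -- family centraliser, so the commutator does not change.
    · rintro f hf g ⟨x', hx', y', hy', e⟩
      refine ⟨x', hx', y', hy', ?_⟩
      obtain ⟨B, hB, hfB⟩ := h.mem_family f hf
      have bx := hcomm f hf B hB hfB x' hx'.2
      have by' := hcomm f hf B hB hfB y' hy'.2
      have ox := hFV f hf x' hx'.2
      have oy := hFV f hf y' hy'.2
      have e2 := commutator_mul_mul_eq (h.mul_comm hab hB bx by')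
        (mem_familyCentralizer.1 hx'.1 B hB _ bx ox) (mem_familyCentralizer.1 hy'.1 B hB _ bx ox)
        (mem_familyCentralizer.1 hx'.1 B hB _ by' oy) (mem_familyCentralizer.1 hy'.1 B hB _ by' oy)
      rw [← e2]
      calc _ = f * (g * (x * y * x⁻¹ * y⁻¹) * g⁻¹) * f⁻¹ := by group
        _ = _ := by rw [e]; group
  have h1 : x * y * x⁻¹ * y⁻¹ = 1 := by
    refine hG.eq_one_of_forall_conj_mem hVc fun g => ?_
    obtain ⟨x', hx', y', hy', e⟩ := key g
    rw [e]
    exact V.mul_mem (V.mul_mem (V.mul_mem hx'.2 hy'.2) (V.inv_mem hx'.2)) (V.inv_mem hy'.2)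
  rwa [mul_inv_eq_one, mul_inv_eq_iff_eq_mul] at h1

/-- The members `B` are treated one at a time, keeping a nontrivial `Z` normalised by `O`. If `Z` is
disjoint from `B ⊓ O`, the two normalise each other and hence commute; otherwise `Z` shrinks to the
intersection, which commutes with `B` because `B` is abelian. -/
theorem familyCentralizer_inf_ne_bot (h : GeneratingFamily A U F 𝒜)
    (hG : IsCompactlyGeneratedSimple G) (hA : IsLocallyNormal A)
    (hab : ∀ x ∈ A, ∀ y ∈ A, x * y = y * x) {O V : Subgroup G} (hOc : IsCompact (O : Set G))
    (hOo : IsOpen (O : Set G)) (hO𝒜 : ∀ B ∈ 𝒜, O ≤ Subgroup.normalizer (B : Set G))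
    (hV : IsOpen (V : Set G)) : familyCentralizer 𝒜 O ⊓ V ≠ ⊥ := by
  have key : ∃ Z : Subgroup G, Z ≠ ⊥ ∧ IsLocallyNormal Z ∧ Z ≤ O ∧
      O ≤ Subgroup.normalizer (Z : Set G) ∧ ∀ B ∈ 𝒜, ∀ b ∈ B, b ∈ O → ∀ z ∈ Z, b * z = z * b := by
    refine Set.Finite.induction_on_subset 𝒜 h.finite_family
      (motive := fun 𝒮 _ => ∃ Z : Subgroup G, Z ≠ ⊥ ∧
      IsLocallyNormal Z ∧ Z ≤ O ∧ O ≤ Subgroup.normalizer (Z : Set G) ∧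
      ∀ B ∈ 𝒮, ∀ b ∈ B, b ∈ O → ∀ z ∈ Z, b * z = z * b) ?_ ?_
    · refine ⟨O, ?_, isLocallyNormal_of_isCompact_of_isOpen hOc hOo, le_rfl,
        Subgroup.le_normalizer, by simp⟩
      rintro rfl
      exact hG.nondiscrete (discreteTopology_of_isOpen_singleton_one (by simpa using hOo))
    · rintro B 𝒮 hB _ _ ⟨Z, hZ1, hZ, hZO, hOZ, hZ𝒮⟩
      have hOB : O ≤ Subgroup.normalizer ((B ⊓ O : Subgroup G) : Set G) :=
        le_normalizer_of_conj_mem fun u hu b hb => ⟨conj_mem_of_le_normalizer (hO𝒜 B hB) hu hb.1,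
          O.mul_mem (O.mul_mem hu hb.2) (O.inv_mem hu)⟩
      by_cases hZB : Z ⊓ (B ⊓ O) = ⊥
      · refine ⟨Z, hZ1, hZ, hZO, hOZ, ?_⟩
        rintro C (rfl | hC) b hb hbO z hz
        · exact (mul_comm_of_conj_mem hZB hz ⟨hb, hbO⟩
            (conj_mem_of_le_normalizer hOB (hZO hz) ⟨hb, hbO⟩)
            (conj_mem_of_le_normalizer hOZ hbO (Z.inv_mem hz))).symm
        · exact hZ𝒮 C hC b hb hbO z hz
      · refine ⟨Z ⊓ (B ⊓ O), hZB, hZ.inf ((h.isLocallyNormal hA hB).inf_of_isOpen hOo),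
          inf_le_left.trans hZO, le_normalizer_of_conj_mem fun u hu z hz =>
            ⟨conj_mem_of_le_normalizer hOZ hu hz.1, conj_mem_of_le_normalizer hOB hu hz.2⟩, ?_⟩
        rintro C (rfl | hC) b hb hbO z hz
        · exact h.mul_comm hab hB hb hz.2.1
        · exact hZ𝒮 C hC b hb hbO z hz.1
  obtain ⟨Z, hZ1, hZ, -, -, hZ𝒜⟩ := key
  intro hbot
  refine hZ1 (hG.eq_bot_of_inf_eq_bot hZ hV (eq_bot_iff.2 (hbot ▸ ?_)))
  exact fun z hz => ⟨mem_familyCentralizer.2 fun B hB b hb hbO => hZ𝒜 B hB b hb hbO z hz.1, hz.2⟩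

/-- The local centraliser of the family survives conjugation by all of `G`, at the cost of a smaller
`O'`. For `f` in a member `B`, a small `u` in another member changes `f` only by a small element of
`B`, which commutes both with `f` and with the conjugated element. -/
theorem exists_conj_mem_familyCentralizer (h : GeneratingFamily A U F 𝒜) (hA : IsLocallyNormal A)
    (hab : ∀ x ∈ A, ∀ y ∈ A, x * y = y * x) {D O : Subgroup G} (hO : IsOpen (O : Set G))
    (hD : D ≤ familyCentralizer 𝒜 O) (g : G) :
    ∃ O' : Subgroup G, IsOpen (O' : Set G) ∧ ∀ x ∈ D, g * x * g⁻¹ ∈ familyCentralizer 𝒜 O' := by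
  revert g
  refine h.induction _ ⟨O, hO, fun x hx => by simpa using hD hx⟩ ?_ ?_
  · rintro u hu g ⟨O', hO', hD'⟩
    refine ⟨MulAut.conj u • O', isOpen_conj_smul hO' u, fun x hx => ?_⟩
    have := _root_.conj_mem_familyCentralizer (h.conj_mem _ (U.inv_mem hu)) (hD' x hx)
    simpa [mul_assoc] using this
  · rintro f hf g ⟨O', hO', hD'⟩
    obtain ⟨B, hB, hfB⟩ := h.mem_family f hf
    have ht : Filter.Tendsto (fun v : G => v * f * v⁻¹ * f⁻¹) (𝓝 1) (𝓝 1) := by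
      have : Continuous (fun v : G => v * f * v⁻¹ * f⁻¹) := by fun_prop
      simpa using this.tendsto 1
    have hO'1 := hO'.mem_nhds O'.one_mem
    obtain ⟨W, -, hWo, hW⟩ := exists_isOpen_subgroup_subset (Filter.inter_mem (ht hO'1)
      (Filter.inter_mem hO'1 ((h.isLocallyNormal hA hB).2.mem_nhds (Subgroup.one_mem _))))
    refine ⟨W, hWo, fun x hx => ?_⟩
    have hx' := mem_familyCentralizer.1 (hD' x hx)
    rw [mem_familyCentralizer]
    intro C hC u hu huW
    obtain ⟨h1, h2, h3⟩ := hW huW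
    set y := g * x * g⁻¹ with hy
    have hb : u * f * u⁻¹ * f⁻¹ ∈ B :=
      B.mul_mem (conj_mem_of_le_normalizer le_rfl h3 hfB) (B.inv_mem hfB)
    have hby : Commute (u * f * u⁻¹ * f⁻¹) y := hx' B hB _ hb h1
    have hbf : Commute (u * f * u⁻¹ * f⁻¹) f := h.mul_comm hab hB hb hfB
    have huy : u * y = y * u := hx' C hC u hu h2
    have e : f * g * x * (f * g)⁻¹ = f * y * f⁻¹ := by rw [hy]; group
    rw [e]
    have huf : u * f = (u * f * u⁻¹ * f⁻¹) * f * u := by group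
    have hc : Commute (u * f * u⁻¹ * f⁻¹) (f * y * f⁻¹) :=
      (hbf.mul_right hby).mul_right hbf.inv_right
    calc u * (f * y * f⁻¹) = (u * f) * y * f⁻¹ := by group
      _ = (u * f * u⁻¹ * f⁻¹) * f * (u * y) * f⁻¹ := by rw [huf]; group
      _ = (u * f * u⁻¹ * f⁻¹) * (f * y * f⁻¹) * (f * u * f⁻¹) := by rw [huy]; group
      _ = (f * y * f⁻¹) * u := by rw [hc.eq]; group

/-- Conjugating `D` so that the given conjugate of `A` becomes a member of the family reduces this
to `exists_conj_mem_familyCentralizer`. -/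
theorem exists_commute_conj (h : GeneratingFamily A U F 𝒜) (hA : IsLocallyNormal A)
    (hab : ∀ x ∈ A, ∀ y ∈ A, x * y = y * x) {D O : Subgroup G} (hO : IsOpen (O : Set G))
    (hD : D ≤ familyCentralizer 𝒜 O) (g : G) :
    ∀ᶠ a in 𝓝 (1 : G), a ∈ MulAut.conj g • A → ∀ x ∈ D, a * x = x * a := by
  obtain ⟨B, hB⟩ := h.nonempty
  obtain ⟨k, rfl⟩ := h.eq_conj B hB
  obtain ⟨O', hO', hD'⟩ := h.exists_conj_mem_familyCentralizer hA hab hO hD (k * g⁻¹)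
  have ht : Filter.Tendsto (fun a : G => (k * g⁻¹) * a * (k * g⁻¹)⁻¹) (𝓝 1) (𝓝 1) := by
    have : Continuous (fun a : G => (k * g⁻¹) * a * (k * g⁻¹)⁻¹) := by fun_prop
    simpa using this.tendsto 1
  filter_upwards [ht (hO'.mem_nhds O'.one_mem)] with a ha haA x hx
  rw [mem_conj_smul] at haA
  have h1 := mem_familyCentralizer.1 (hD' x hx) _ hB ((k * g⁻¹) * a * (k * g⁻¹)⁻¹)
    (by rw [mem_conj_smul]; simpa [mul_assoc] using haA) ha
  have h2 := congrArg (fun y => (k * g⁻¹)⁻¹ * y * (k * g⁻¹)) h1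
  simpa [mul_assoc] using h2

end GeneratingFamily

/-- There are no nontrivial abelian locally normal subgroups. -/
theorem IsCompactlyGeneratedSimple.eq_bot_of_mul_comm (hG : IsCompactlyGeneratedSimple G)
    {A : Subgroup G} (hA : IsLocallyNormal A) (hab : ∀ x ∈ A, ∀ y ∈ A, x * y = y * x) :
    A = ⊥ := by
  by_contra hA1
  obtain ⟨U, hUc, hUo⟩ := exists_isCompact_isOpen_subgroup G
  -- the local centraliser of a generating family
  have step : ∀ (A : Subgroup G), IsLocallyNormal A → A ≠ ⊥ → (∀ x ∈ A, ∀ y ∈ A, x * y = y * x) →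
      ∃ F 𝒜, GeneratingFamily A U F 𝒜 ∧ ∃ O V : Subgroup G, IsOpen (O : Set G) ∧
        IsOpen (V : Set G) ∧ familyCentralizer 𝒜 O ⊓ V ≠ ⊥ ∧
        IsLocallyNormal (familyCentralizer 𝒜 O ⊓ V) ∧
        ∀ x ∈ familyCentralizer 𝒜 O ⊓ V, ∀ y ∈ familyCentralizer 𝒜 O ⊓ V, x * y = y * x := by
    intro A hA hA1 hab
    obtain ⟨F, 𝒜, h⟩ := hG.exists_generatingFamily hA hA1 hUc hUo
    obtain ⟨O, hOc, hOo, -, -, hUO, -, hO𝒜⟩ := h.exists_small hA hUc hUo Filter.univ_mem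
    obtain ⟨V, hVc, hVo, -, -, hUV, hFV, hV𝒜⟩ :=
      h.exists_small hA hUc hUo (hOo.mem_nhds O.one_mem)
    refine ⟨F, 𝒜, h, O, V, hOo, hVo, h.familyCentralizer_inf_ne_bot hG hA hab hOc hOo hO𝒜 hVo, ?_,
      fun x hx y hy => h.mul_comm_of_mem_familyCentralizer hG hab hUO hVc hUV hFV hV𝒜 hx hy⟩
    refine isLocallyNormal_of_le_normalizer (hVc.inter_left (isClosed_familyCentralizer _ _)) hUo
      (le_normalizer_of_conj_mem fun u hu x hx => ⟨h.conj_mem_familyCentralizer hUO hu hx.1,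
        conj_mem_of_le_normalizer hUV hu hx.2⟩)
  -- Centralising twice: `D` commutes locally with every conjugate of `A`, so `A` and its conjugates
  -- lie locally in the centraliser of a family of conjugates of `D`, which is again locally
  -- abelian.
  obtain ⟨F, 𝒜, h, O, V, hO, -, hD1, hD, hDab⟩ := step A hA hA1 hab
  set D := familyCentralizer 𝒜 O ⊓ V
  obtain ⟨F', ℬ, h', O', V', hO', hV', -, -, hEab⟩ := step D hD hD1 hDab
  -- the members of `𝒜` commute locally
  have hcomm : ∀ᶠ a in 𝓝 (1 : G), ∀ B ∈ 𝒜, a ∈ B → a ∈ familyCentralizer ℬ O' ⊓ V' := by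
    have h1 : ∀ᶠ a in 𝓝 (1 : G), ∀ B ∈ 𝒜, ∀ C ∈ ℬ, a ∈ B → ∀ x ∈ C, a * x = x * a := by
      refine (Filter.eventually_all_finite h.finite_family).2 fun B hB =>
        (Filter.eventually_all_finite h'.finite_family).2 fun C hC => ?_
      obtain ⟨g, rfl⟩ := h.eq_conj B hB
      obtain ⟨k, rfl⟩ := h'.eq_conj C hC
      have ht : Filter.Tendsto (fun a : G => k⁻¹ * a * k) (𝓝 1) (𝓝 1) := by
        have : Continuous (fun a : G => k⁻¹ * a * k) := by fun_prop
        simpa using this.tendsto 1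
      filter_upwards [ht.eventually (h.exists_commute_conj hA hab hO (D := D) inf_le_left
        (k⁻¹ * g))] with a ha haB x hx
      rw [mem_conj_smul] at hx haB
      have h2 := ha (by rw [mem_conj_smul]; simpa [mul_assoc] using haB) _ hx
      have h3 := congrArg (fun y => k * y * k⁻¹) h2
      simpa [mul_assoc] using h3
    filter_upwards [h1, hV'.mem_nhds V'.one_mem] with a ha haV B hB haB
    exact ⟨mem_familyCentralizer.2 fun C hC x hx _ => (ha B hB C hC haB x hx).symm, haV⟩
  -- Three nested scales: the members of `𝒜` commute with each other inside `P`, commutators of `F`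
  -- with `Q` fall into `P`, and those with `R` fall into `Q`.
  obtain ⟨P, hPc, hPo, hPcomm, -, hUP, -, hP𝒜⟩ := h.exists_small hA hUc hUo hcomm
  obtain ⟨Q, hQc, hQo, hQP, -, hUQ, hFQ, hQ𝒜⟩ :=
    h.exists_small hA hUc hUo (hPo.mem_nhds P.one_mem)
  obtain ⟨R, -, hRo, hRQ, -, hUR, hFR, hR𝒜⟩ :=
    h.exists_small hA hUc hUo (hQo.mem_nhds Q.one_mem)
  set E := familyCentralizer 𝒜 P ⊓ Q with hE
  have hEab' : ∀ x ∈ E, ∀ y ∈ E, x * y = y * x := fun x hx y hy =>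
    h.mul_comm_of_mem_familyCentralizer hG hab hUP hQc hUQ hFQ hQ𝒜 hx hy
  have hE1 : E ≠ ⊥ := h.familyCentralizer_inf_ne_bot hG hA hab hPc hPo hP𝒜 hQo
  have hUE : U ≤ Subgroup.normalizer (E : Set G) := le_normalizer_of_conj_mem fun u hu x hx =>
    ⟨h.conj_mem_familyCentralizer hUP hu hx.1, conj_mem_of_le_normalizer hUQ hu hx.2⟩
  have hEc : IsCompact (E : Set G) := hQc.inter_left (isClosed_familyCentralizer _ _)
  have hELN : IsLocallyNormal E := isLocallyNormal_of_le_normalizer hEc hUo hUE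
  have hBE : ∀ B ∈ 𝒜, ∀ b ∈ B, b ∈ Q → b ∈ E := fun B hB b hb hbQ =>
    ⟨mem_familyCentralizer.2 fun C hC c hc hcP =>
      hEab _ (hPcomm hcP C hC hc) _ (hPcomm (hQP hbQ) B hB hb), hbQ⟩
  -- `E` is commensurated
  have hcommens : ∀ g : G, ∃ W : Subgroup G, IsOpen (W : Set G) ∧
      ∀ x ∈ E, x ∈ W → g * x * g⁻¹ ∈ E := by
    refine h.induction _ ⟨⊤, isOpen_univ, fun x hx _ => by simpa using hx⟩ ?_ ?_
    · rintro u hu g ⟨W, hW, hWE⟩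
      refine ⟨W, hW, fun x hx hxW => ?_⟩
      have := conj_mem_of_le_normalizer hUE hu (hWE x hx hxW)
      simpa [mul_assoc] using this
    · rintro f hf g ⟨W, hW, hWE⟩
      refine ⟨W ⊓ MulAut.conj g⁻¹ • R, hW.inter (isOpen_conj_smul hRo _), fun x hx hxW => ?_⟩
      obtain ⟨B, hB, hfB⟩ := h.mem_family f hf
      have hyE := hWE x hx hxW.1
      have hyR : g * x * g⁻¹ ∈ R := by simpa using mem_conj_smul.1 hxW.2
      set y := g * x * g⁻¹ with hy
      -- The commutator lies in a member of `𝒜` and in `Q`, hence in `E` by `hBE`; conjugation by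
      -- `f` therefore changes `y` only within `E`.
      have hc : f * y * f⁻¹ * y⁻¹ ∈ E := by
        refine hBE B hB _ ?_ (hFR f hf y hyR)
        have := B.mul_mem hfB (conj_mem_of_le_normalizer (hR𝒜 B hB) hyR (B.inv_mem hfB))
        simpa [mul_assoc] using this
      have := E.mul_mem hc hyE
      have e : f * g * x * (f * g)⁻¹ = f * y * f⁻¹ * y⁻¹ * y := by rw [hy]; group
      rwa [e]
  -- Small elements of `E` lie in any given conjugate of `E`, which is abelian. So each conjugate
  -- centralises `E` locally, which forces `E` to be discrete.
  obtain ⟨W, hWo, hW⟩ := hG.exists_inf_eq_bot_of_eventually_commute hELN hE1 fun f g hg => by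
    obtain ⟨W, hW, hWE⟩ := hcommens g⁻¹
    filter_upwards [hW.mem_nhds W.one_mem] with x hxW hxE
    have h1 := hWE x hxE hxW
    rw [mem_conj_smul] at hg
    have h2 := congrArg (fun y => g * y * g⁻¹) (hEab' _ hg _ h1)
    simpa [mul_assoc] using h2
  exact hE1 (hG.eq_bot_of_inf_eq_bot hELN hWo hW)

end Abelian

/-! ### The order of the centraliser lattice and the dynamics of conjugation on it -/

section Lattice

variable {G : Type*} [Group G]

theorem conj_smul_inf_eq_bot_iff {g : G} {K L : Subgroup G} :
    MulAut.conj g • K ⊓ MulAut.conj g • L = ⊥ ↔ K ⊓ L = ⊥ := by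
  rw [← Subgroup.smul_inf, conj_smul_eq_bot_iff]

theorem conj_smul_inf_eq_bot_iff' {g : G} {K L : Subgroup G} :
    MulAut.conj g • K ⊓ L = ⊥ ↔ K ⊓ MulAut.conj g⁻¹ • L = ⊥ := by
  rw [← conj_smul_inf_eq_bot_iff (g := g) (L := MulAut.conj g⁻¹ • L), ← conj_mul_smul,
    mul_inv_cancel, map_one, one_smul]

theorem conj_smul_eq_of_inv_mul_mem_normalizer {x y : G} {K : Subgroup G}
    (h : y⁻¹ * x ∈ Subgroup.normalizer (K : Set G)) : MulAut.conj x • K = MulAut.conj y • K := by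
  calc MulAut.conj x • K = MulAut.conj (y * (y⁻¹ * x)) • K := by rw [mul_inv_cancel_left]
    _ = MulAut.conj y • K := by rw [conj_mul_smul, conj_smul_eq_self_of_mem_normalizer h]

variable [TopologicalSpace G]

/-- The order of the centraliser lattice: every locally normal subgroup disjoint from `L` is
disjoint from `K`. -/
def LocallyLE (K L : Subgroup G) : Prop :=
  ∀ M : Subgroup G, IsLocallyNormal M → M ⊓ L = ⊥ → M ⊓ K = ⊥

theorem LocallyLE.trans {K L N : Subgroup G} (h : LocallyLE K L) (h' : LocallyLE L N) :
    LocallyLE K N := fun M hM hMN => h M hM (h' M hM hMN)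

theorem LocallyLE.refl (K : Subgroup G) : LocallyLE K K := fun _ _ h => h

theorem LocallyLE.conj [IsTopologicalGroup G] {K L : Subgroup G} (h : LocallyLE K L) (g : G) :
    LocallyLE (MulAut.conj g • K) (MulAut.conj g • L) := by
  intro M hM hML
  rw [inf_comm, conj_smul_inf_eq_bot_iff', inf_comm] at *
  exact h _ (hM.conj _) hML

variable [IsTopologicalGroup G]

/-- The action on the centraliser lattice separates a compact set from `1` by finitely many
locally normal subgroups. -/
theorem exists_finite_separating
    (hfaith : ∀ y : G, y ≠ 1 →
      ∃ Γ : Subgroup G, IsLocallyNormal Γ ∧ Γ ≠ ⊥ ∧ MulAut.conj y • Γ ⊓ Γ = ⊥)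
    {C : Set G} (hC : IsCompact C) (h1 : (1 : G) ∉ C) :
    ∃ 𝒯 : Set (Subgroup G), 𝒯.Finite ∧ (∀ Γ ∈ 𝒯, IsLocallyNormal Γ ∧ Γ ≠ ⊥) ∧
      ∀ x ∈ C, ∃ Γ ∈ 𝒯, MulAut.conj x • Γ ⊓ Γ = ⊥ := by
  choose! Γ hΓ hΓ1 hΓ2 using hfaith
  have hne : ∀ x ∈ C, x ≠ 1 := fun x hx h => h1 (h ▸ hx)
  obtain ⟨t, htC, ht⟩ := hC.elim_nhds_subcover
    (fun y => (fun x => y⁻¹ * x) ⁻¹' (Subgroup.normalizer (Γ y : Set G) : Set G))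
    fun y hy => ((hΓ y (hne y hy)).2.preimage (by fun_prop)).mem_nhds (by simp)
  refine ⟨Γ '' t, t.finite_toSet.image _, ?_, fun x hx => ?_⟩
  · rintro _ ⟨y, hy, rfl⟩
    exact ⟨hΓ y (hne y (htC y hy)), hΓ1 y (hne y (htC y hy))⟩
  · obtain ⟨y, hy, hxy⟩ := Set.mem_iUnion₂.1 (ht hx)
    refine ⟨Γ y, ⟨y, hy, rfl⟩, ?_⟩
    rw [conj_smul_eq_of_inv_mul_mem_normalizer hxy]
    exact hΓ2 y (hne y (htC y hy))

variable [T2Space G] [LocallyCompactSpace G] [TotallyDisconnectedSpace G]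

namespace IsCompactlyGeneratedSimple

/-- Inside `P` this subgroup centralises itself, so it is an abelian locally normal subgroup. -/
theorem inf_centralizer_eq_bot (hG : IsCompactlyGeneratedSimple G) {B P : Subgroup G}
    (hB : IsLocallyNormal B) (hP : IsOpen (P : Set G)) :
    B ⊓ Subgroup.centralizer ((B ⊓ P : Subgroup G) : Set G) = ⊥ := by
  have hLN : IsLocallyNormal (B ⊓ Subgroup.centralizer ((B ⊓ P : Subgroup G) : Set G)) := by
    refine isLocallyNormal_of_le_normalizer (hB.1.inter_right (Set.isClosed_centralizer _))
      (hB.2.inter hP) (U := Subgroup.normalizer (B : Set G) ⊓ P)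
      (le_normalizer_of_conj_mem fun u hu x hx => ⟨conj_mem_of_le_normalizer le_rfl hu.1 hx.1, ?_⟩)
    refine Subgroup.mem_centralizer_iff.2 fun b hb => ?_
    have hb' : u⁻¹ * b * u ∈ B ⊓ P := by
      refine ⟨?_, P.mul_mem (P.mul_mem (P.inv_mem hu.2) hb.2) hu.2⟩
      have := conj_mem_of_le_normalizer le_rfl (Subgroup.inv_mem _ hu.1) hb.1
      simpa using this
    have h1 := Subgroup.mem_centralizer_iff.1 hx.2 _ hb'
    have h2 := congrArg (fun y => u * y * u⁻¹) h1
    simpa [mul_assoc] using h2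
  refine hG.eq_bot_of_inf_eq_bot hLN hP (hG.eq_bot_of_mul_comm (hLN.inf_of_isOpen hP) ?_)
  intro x hx y hy
  exact Subgroup.mem_centralizer_iff.1 hy.1.2 x ⟨hx.1.1, hx.2⟩

/-- Disjoint locally normal subgroups commute locally. -/
theorem eventually_commute (hG : IsCompactlyGeneratedSimple G) {B M : Subgroup G}
    (hB : IsLocallyNormal B) (hM : IsLocallyNormal M) (h : B ⊓ M = ⊥) :
    ∀ᶠ m in 𝓝 (1 : G), m ∈ M → ∀ b ∈ B, b * m = m * b := by
  obtain ⟨O, -, hOo, hO⟩ := exists_isOpen_subgroup_subset (Filter.inter_mem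
    (hB.2.mem_nhds (Subgroup.one_mem _)) (hM.2.mem_nhds (Subgroup.one_mem _)))
  have hcomm : ∀ b ∈ B, b ∈ O → ∀ m ∈ M, m ∈ O → b * m = m * b := fun b hb hbO m hm hmO =>
    mul_comm_of_conj_mem h hb hm (conj_mem_of_le_normalizer le_rfl (hO hbO).2 hm)
      (conj_mem_of_le_normalizer le_rfl (hO hmO).1 (B.inv_mem hb))
  obtain ⟨P, -, hPo, hP⟩ := exists_isOpen_subgroup_subset (Filter.inter_mem
    (hOo.mem_nhds O.one_mem) (eventually_conj_mem hB.1 (hOo.mem_nhds O.one_mem)))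
  filter_upwards [hPo.mem_nhds P.one_mem] with m hmP hmM b hb
  -- Both `m` and `b * m * b⁻¹` centralise `B ⊓ P`, since `P` is small enough for its conjugates
  -- under `B` to stay in `O`.
  have hc : b * m * b⁻¹ * m⁻¹ ∈ B ⊓ Subgroup.centralizer ((B ⊓ P : Subgroup G) : Set G) := by
    refine ⟨?_, Subgroup.mem_centralizer_iff.2 fun x hx => ?_⟩
    · have := B.mul_mem hb (conj_mem_of_le_normalizer le_rfl (hO (hP hmP).1).1 (B.inv_mem hb))
      simpa [mul_assoc] using this
    · have h1 : Commute x m := hcomm x hx.1 (hP hx.2).1 m hmM (hP hmP).1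
      have hxb : b⁻¹ * x * b ∈ B := B.mul_mem (B.mul_mem (B.inv_mem hb) hx.1) hb
      have hxO : b⁻¹ * x * b ∈ O := by simpa using (hP hx.2).2 b⁻¹ (B.inv_mem hb)
      have h2 : Commute x (b * m * b⁻¹) := by
        have h3 := congrArg (fun y => b * y * b⁻¹) (hcomm _ hxb hxO m hmM (hP hmP).1)
        have : x * (b * m * b⁻¹) = b * m * b⁻¹ * x := by simpa [mul_assoc] using h3
        exact this
      exact (h2.mul_right h1.inv_right).eq
  rw [hG.inf_centralizer_eq_bot hB hPo, Subgroup.mem_bot, mul_inv_eq_one,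
    mul_inv_eq_iff_eq_mul] at hc
  exact hc

/-- If `M` is disjoint from `B`, then `y` commutes with small elements of `M`. Those that lie in `Γ`
also lie in its conjugate by `y`, hence are trivial. -/
theorem locallyLE_of_mem (hG : IsCompactlyGeneratedSimple G) {B Γ : Subgroup G}
    (hB : IsLocallyNormal B) (hΓ : IsLocallyNormal Γ) {y : G} (hy : y ∈ B)
    (h : MulAut.conj y • Γ ⊓ Γ = ⊥) : LocallyLE Γ B := by
  intro M hM hMB
  obtain ⟨W, -, hWo, hW⟩ := exists_isOpen_subgroup_subset
    (hG.eventually_commute hB hM (inf_comm M B ▸ hMB))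
  refine hG.eq_bot_of_inf_eq_bot (hM.inf hΓ) hWo ((Subgroup.eq_bot_iff_forall _).2 fun x hx => ?_)
  have h1 : y * x = x * y := hW hx.2 hx.1.1 y hy
  have h2 : x ∈ MulAut.conj y • Γ ⊓ Γ := by
    refine ⟨?_, hx.1.2⟩
    have := conj_smul_mem (g := y) hx.1.2
    rwa [h1, mul_inv_cancel_right] at this
  rwa [h] at h2

/-- If there are two disjoint nontrivial locally normal subgroups then the action on the
centraliser lattice is faithful. -/
theorem exists_conj_smul_inf_eq_bot (hG : IsCompactlyGeneratedSimple G) {K M : Subgroup G}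
    (hK : IsLocallyNormal K) (hM : IsLocallyNormal M) (hK1 : K ≠ ⊥) (hM1 : M ≠ ⊥)
    (hKM : M ⊓ K = ⊥) {y : G} (hy : y ≠ 1) :
    ∃ Γ : Subgroup G, IsLocallyNormal Γ ∧ Γ ≠ ⊥ ∧ MulAut.conj y • Γ ⊓ Γ = ⊥ := by
  -- The kernel of the action on the lattice, phrased as preservation of disjointness. It is closed
  -- because normalisers of locally normal subgroups are open.
  let T : Subgroup G :=
    { carrier := {y | ∀ K M : Subgroup G, IsLocallyNormal K → IsLocallyNormal M → M ⊓ K = ⊥ →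
        M ⊓ MulAut.conj y • K = ⊥}
      one_mem' := fun K M _ _ h => by simpa using h
      mul_mem' := fun {a b} ha hb K M hK hM h => by
        rw [conj_mul_smul]
        exact ha _ M (hK.conj b) hM (hb K M hK hM h)
      inv_mem' := fun {a} ha K M hK hM h => by
        rw [← conj_smul_inf_eq_bot_iff', inf_comm]
        exact ha M K hM hK (inf_comm M K ▸ h) }
  have hTn : T.Normal := by
    refine ⟨fun y hy g K M hK hM h => ?_⟩
    rw [conj_mul_smul, conj_mul_smul, inf_comm, conj_smul_inf_eq_bot_iff', inf_comm]
    refine hy _ _ (hK.conj _) (hM.conj _) (conj_smul_inf_eq_bot_iff.2 h)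
  have hTc : IsClosed (T : Set G) := by
    refine isOpen_compl_iff.1 (isOpen_iff_mem_nhds.2 fun y hy => ?_)
    have hy' : ¬ ∀ K M : Subgroup G, IsLocallyNormal K → IsLocallyNormal M → M ⊓ K = ⊥ →
        M ⊓ MulAut.conj y • K = ⊥ := hy
    push Not at hy'
    obtain ⟨K, M, hK, hM, h, h'⟩ := hy'
    have : (fun x => y⁻¹ * x) ⁻¹' (Subgroup.normalizer (K : Set G) : Set G) ∈ 𝓝 y :=
      (hK.2.preimage (by fun_prop)).mem_nhds (by simp)
    filter_upwards [this] with x hx hxT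
    refine h' ?_
    rw [← conj_smul_eq_of_inv_mul_mem_normalizer hx]
    exact hxT K M hK hM h
  have hT : T = ⊥ := by
    refine (hG.simple.2 T hTn hTc).resolve_right fun hT => hM1 ?_
    have hTtop : ∀ g : G, M ⊓ MulAut.conj g • K = ⊥ := fun g => by
      have : g ∈ T := hT ▸ Subgroup.mem_top g
      exact this K M hK hM hKM
    obtain ⟨W, hWo, hW⟩ := hG.exists_inf_eq_bot_of_eventually_commute hM hK1 fun f g hf => by
      filter_upwards [hG.eventually_commute (hK.conj g) hM (inf_comm M _ ▸ hTtop g)] with x hx hxM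
      exact hx hxM f hf
    exact hG.eq_bot_of_inf_eq_bot hM hWo hW
  have hyT : ¬ ∀ K M : Subgroup G, IsLocallyNormal K → IsLocallyNormal M → M ⊓ K = ⊥ →
      M ⊓ MulAut.conj y • K = ⊥ := by
    intro h
    have : y ∈ T := h
    rw [hT] at this
    exact hy this
  push Not at hyT
  obtain ⟨K, M, hK, hM, h, h'⟩ := hyT
  -- Conjugating this witness by `y⁻¹` puts it inside `K`, which is disjoint from `M`.
  refine ⟨M ⊓ MulAut.conj y • K, hM.inf (hK.conj y), h', ?_⟩
  rw [conj_smul_inf_eq_bot_iff', eq_bot_iff, ← h]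
  refine inf_le_inf inf_le_left ?_
  rw [Subgroup.smul_inf, ← conj_mul_smul, inv_mul_cancel, map_one, one_smul]
  exact inf_le_right

/-- Pairwise disjoint locally normal subgroups converge to `1` inside a compact set. -/
theorem finite_setOf_not_le (hG : IsCompactlyGeneratedSimple G)
    (hfaith : ∀ y : G, y ≠ 1 →
      ∃ Γ : Subgroup G, IsLocallyNormal Γ ∧ Γ ≠ ⊥ ∧ MulAut.conj y • Γ ⊓ Γ = ⊥)
    {ι : Type*} {L : ι → Subgroup G} (hL : ∀ i, IsLocallyNormal (L i))
    (hdisj : ∀ i j, i ≠ j → L i ⊓ L j = ⊥) {U V : Subgroup G} (hU : IsCompact (U : Set G))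
    (hV : IsOpen (V : Set G)) : {i | ¬ L i ⊓ U ≤ V}.Finite := by
  obtain ⟨𝒯, h𝒯, h𝒯1, h𝒯2⟩ := exists_finite_separating hfaith
    (hU.diff hV) (fun h => h.2 V.one_mem)
  have hbad : ∀ i ∈ {i | ¬ L i ⊓ U ≤ V}, ∃ Γ ∈ 𝒯, LocallyLE Γ (L i) := by
    intro i hi
    obtain ⟨x, hx, hxV⟩ := SetLike.not_le_iff_exists.1 hi
    obtain ⟨Γ, hΓ, hxΓ⟩ := h𝒯2 x ⟨hx.2, hxV⟩
    exact ⟨Γ, hΓ, hG.locallyLE_of_mem (hL i) (h𝒯1 Γ hΓ).1 hx.1 hxΓ⟩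
  choose! Γ hΓ hΓL using hbad
  -- Two disjoint members cannot lie above the same nontrivial `Γ`, so the choice of `Γ` is
  -- injective into the finite set `𝒯`.
  refine Set.Finite.of_finite_image (f := Γ)
    (h𝒯.subset (Set.image_subset_iff.2 fun i hi => hΓ i hi)) fun i hi j hj hij => ?_
  by_contra hne
  have h1 := hΓL j hj _ (hL i) (hdisj i j hne)
  rw [← hij] at h1
  have h2 := hΓL i hi _ (h𝒯1 _ (hΓ i hi)).1 (inf_comm (L i) (Γ i) ▸ h1)
  exact (h𝒯1 _ (hΓ i hi)).2 (by simpa using h2)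

/-- There are finitely many locally normal subgroups whose conjugates lie strictly below every
nontrivial locally normal subgroup. -/
theorem exists_finite_minorising (hG : IsCompactlyGeneratedSimple G)
    (hfaith : ∀ y : G, y ≠ 1 →
      ∃ Γ : Subgroup G, IsLocallyNormal Γ ∧ Γ ≠ ⊥ ∧ MulAut.conj y • Γ ⊓ Γ = ⊥) :
    ∃ 𝒯 : Set (Subgroup G), 𝒯.Finite ∧ (∀ Γ ∈ 𝒯, IsLocallyNormal Γ ∧ Γ ≠ ⊥) ∧
      ∀ B : Subgroup G, IsLocallyNormal B → B ≠ ⊥ → ∃ Γ ∈ 𝒯, ∃ g : G,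
        LocallyLE (MulAut.conj g • Γ) B ∧ ∃ M : Subgroup G, IsLocallyNormal M ∧ M ≠ ⊥ ∧
          LocallyLE M B ∧ M ⊓ MulAut.conj g • Γ = ⊥ := by
  obtain ⟨U, hUc, hUo⟩ := exists_isCompact_isOpen_subgroup G
  obtain ⟨F, hF, -, -, hind⟩ := hG.exists_finite_generating (hG.ne_bot_of_isOpen hUo) hUo
  have hev : ∀ᶠ v in 𝓝 (1 : G), ∀ f ∈ F, f * v * f⁻¹ ∈ U := by
    refine (Filter.eventually_all_finite hF).2 fun f _ => ?_
    have ht : Filter.Tendsto (fun v : G => f * v * f⁻¹) (𝓝 1) (𝓝 1) := by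
      have : Continuous (fun v : G => f * v * f⁻¹) := by fun_prop
      simpa using this.tendsto 1
    exact ht (hUo.mem_nhds U.one_mem)
  obtain ⟨V, -, hVo, hV⟩ := exists_isOpen_subgroup_subset hev
  obtain ⟨𝒯, h𝒯, h𝒯1, h𝒯2⟩ := exists_finite_separating hfaith
    (hUc.diff hVo) (fun h => h.2 V.one_mem)
  refine ⟨𝒯, h𝒯, h𝒯1, fun B hB hB1 => ?_⟩
  -- If every conjugate of `B` met `U` only inside `V`, the choice of `V` would keep all conjugates
  -- of an element of `B ⊓ U` in `U`.
  have hg : ∃ g x : G, x ∈ MulAut.conj g • B ∧ x ∈ U ∧ x ∉ V := by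
    by_contra! hcon
    refine hB1 (hG.eq_bot_of_inf_eq_bot hB hUo ((Subgroup.eq_bot_iff_forall _).2 fun x hx => ?_))
    refine hG.eq_one_of_forall_conj_mem hUc (hind _ (by simpa using hx.2) ?_ ?_)
    · intro u hu g hg
      have := U.mul_mem (U.mul_mem hu hg) (U.inv_mem hu)
      simpa [mul_assoc] using this
    · intro f hf g hg
      have := hV (hcon g _ (conj_smul_mem hx.1) hg) f hf
      simpa [mul_assoc] using this
  obtain ⟨g, x, hxB, hxU, hxV⟩ := hg
  obtain ⟨Γ, hΓ, hxΓ⟩ := h𝒯2 x ⟨hxU, hxV⟩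
  have hΓLN := (h𝒯1 Γ hΓ).1
  have hcancel : MulAut.conj g⁻¹ • MulAut.conj g • B = B := by
    rw [← conj_mul_smul, inv_mul_cancel, map_one, one_smul]
  have h1 := (hG.locallyLE_of_mem (hB.conj g) hΓLN hxB hxΓ).conj g⁻¹
  -- The conjugate of `Γ` by `x` also lies below, being moved off itself by `x⁻¹`; this second
  -- piece, disjoint from `Γ`, makes the inequality strict.
  have h2 := (hG.locallyLE_of_mem (hB.conj g) (hΓLN.conj x) (y := x⁻¹) (Subgroup.inv_mem _ hxB)
    (by rw [← conj_mul_smul, inv_mul_cancel, map_one, one_smul, inf_comm]; exact hxΓ)).conj g⁻¹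
  rw [hcancel] at h1 h2
  refine ⟨Γ, hΓ, g⁻¹, h1, MulAut.conj g⁻¹ • MulAut.conj x • Γ, (hΓLN.conj x).conj _, ?_, h2, ?_⟩
  · rw [Ne, conj_smul_eq_bot_iff, conj_smul_eq_bot_iff]
    exact (h𝒯1 Γ hΓ).2
  · exact conj_smul_inf_eq_bot_iff.2 hxΓ

/-- There is a nontrivial locally normal subgroup which wanders under some element. -/
theorem exists_wandering (hG : IsCompactlyGeneratedSimple G)
    (hfaith : ∀ y : G, y ≠ 1 →
      ∃ Γ : Subgroup G, IsLocallyNormal Γ ∧ Γ ≠ ⊥ ∧ MulAut.conj y • Γ ⊓ Γ = ⊥) :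
    ∃ (t : G) (L : Subgroup G), IsLocallyNormal L ∧ L ≠ ⊥ ∧
      ∀ i j : ℤ, i ≠ j → MulAut.conj (t ^ i) • L ⊓ MulAut.conj (t ^ j) • L = ⊥ := by
  obtain ⟨𝒯, h𝒯, h𝒯1, hmin⟩ := hG.exists_finite_minorising hfaith
  obtain ⟨U, hUc, hUo⟩ := exists_isCompact_isOpen_subgroup G
  have hnext : ∀ s : 𝒯 × G, ∃ s' : 𝒯 × G,
      LocallyLE (MulAut.conj s'.2 • (s'.1 : Subgroup G)) (MulAut.conj s.2 • (s.1 : Subgroup G)) ∧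
      ∃ M : Subgroup G, IsLocallyNormal M ∧ M ≠ ⊥ ∧
        LocallyLE M (MulAut.conj s.2 • (s.1 : Subgroup G)) ∧
        M ⊓ MulAut.conj s'.2 • (s'.1 : Subgroup G) = ⊥ := by
    rintro ⟨⟨Γ, hΓ⟩, g⟩
    obtain ⟨Γ', hΓ', g', h1, h2⟩ := hmin (MulAut.conj g • Γ) ((h𝒯1 Γ hΓ).1.conj g)
      (by rw [Ne, conj_smul_eq_bot_iff]; exact (h𝒯1 Γ hΓ).2)
    exact ⟨⟨⟨Γ', hΓ'⟩, g'⟩, h1, h2⟩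
  choose next hnext1 hnext2 using hnext
  obtain ⟨Γ₀, hΓ₀, -⟩ := hmin U (isLocallyNormal_of_isCompact_of_isOpen hUc hUo)
    (hG.ne_bot_of_isOpen hUo)
  let s : ℕ → 𝒯 × G := fun n => next^[n] ⟨⟨Γ₀, hΓ₀⟩, 1⟩
  have hs : ∀ n, s (n + 1) = next (s n) := fun n => Function.iterate_succ_apply' _ _ _
  let B : ℕ → Subgroup G := fun n => MulAut.conj (s n).2 • ((s n).1 : Subgroup G)
  have hB : ∀ n, LocallyLE (B (n + 1)) (B n) := fun n => by
    have := hnext1 (s n)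
    rwa [← hs] at this
  have hanti : ∀ m n, m ≤ n → LocallyLE (B n) (B m) := fun m n hmn => by
    induction n, hmn using Nat.le_induction with
    | base => exact LocallyLE.refl _
    | succ n _ ih => exact (hB n).trans ih
  have : Finite 𝒯 := h𝒯
  -- Along the infinite descending chain two terms are conjugates of the same `Γ` in the finite set,
  -- so `t` below carries `B a` to the smaller `B b`.
  obtain ⟨a, b, hab, hsab⟩ : ∃ a b, a < b ∧ (s a).1 = (s b).1 := by
    obtain ⟨a, b, hne, h⟩ := Finite.exists_ne_map_eq_of_infinite (fun n => (s n).1)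
    rcases lt_or_gt_of_ne hne with h' | h'
    · exact ⟨a, b, h', h⟩
    · exact ⟨b, a, h', h.symm⟩
  obtain ⟨M, hM, hM1, hMB, hMdisj⟩ := hnext2 (s a)
  rw [← hs] at hMdisj
  have hMb : M ⊓ B b = ⊥ := hanti _ _ hab M hM hMdisj
  set t : G := (s b).2 * (s a).2⁻¹ with ht
  have htB : MulAut.conj t • B a = B b := by
    change MulAut.conj t • MulAut.conj (s a).2 • ((s a).1 : Subgroup G) = _
    rw [← conj_mul_smul, ht, inv_mul_cancel_right, hsab]
  -- Positive powers of `t` push `B a`, and `M` below it, under `B b`, from which `M` is disjoint.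
  have hpow : ∀ n : ℕ, LocallyLE (MulAut.conj (t ^ (n + 1)) • B a) (B b) := by
    intro n
    induction n with
    | zero => rw [zero_add, pow_one, htB]; exact LocallyLE.refl _
    | succ n ih =>
      refine LocallyLE.trans ?_ ih
      rw [pow_succ t (n + 1), conj_mul_smul, htB]
      exact (hanti _ _ hab.le).conj _
  have hdisj : ∀ n : ℕ, M ⊓ MulAut.conj (t ^ (n + 1)) • M = ⊥ := fun n =>
    (hMB.conj _) M hM (hpow n M hM hMb)
  have hlt : ∀ i j : ℤ, i < j → MulAut.conj (t ^ i) • M ⊓ MulAut.conj (t ^ j) • M = ⊥ := by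
    intro i j hij
    obtain ⟨n, rfl⟩ := Int.lt.dest hij
    rw [zpow_add, conj_mul_smul, zpow_natCast]
    exact conj_smul_inf_eq_bot_iff.2 (hdisj n)
  refine ⟨t, M, hM, hM1, fun i j hij => ?_⟩
  rcases lt_or_gt_of_ne hij with h | h
  · exact hlt i j h
  · rw [inf_comm]; exact hlt j i h

/-- Disjoint locally normal subgroups commute. -/
theorem mul_comm_of_inf_eq_bot (hG : IsCompactlyGeneratedSimple G)
    (hfaith : ∀ y : G, y ≠ 1 →
      ∃ Γ : Subgroup G, IsLocallyNormal Γ ∧ Γ ≠ ⊥ ∧ MulAut.conj y • Γ ⊓ Γ = ⊥)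
    {B M : Subgroup G} (hB : IsLocallyNormal B) (hM : IsLocallyNormal M) (h : B ⊓ M = ⊥) {b m : G}
    (hb : b ∈ B) (hm : m ∈ M) : b * m = m * b := by
  by_contra hbm
  have hz : b * m * b⁻¹ * m⁻¹ ≠ 1 := by
    rwa [Ne, mul_inv_eq_one, mul_inv_eq_iff_eq_mul]
  obtain ⟨Γ, hΓ, hΓ1, hzΓ⟩ := hfaith _ hz
  -- The commutator moves `Γ` off itself, so it cannot centralise a nontrivial part of `Γ` even
  -- locally.
  have key : ∀ Δ : Subgroup G, IsLocallyNormal Δ → Δ ≤ Γ →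
      (∀ᶠ x in 𝓝 (1 : G), x ∈ Δ → Commute x (b * m * b⁻¹ * m⁻¹)) → Δ = ⊥ := by
    intro Δ hΔ hΔΓ hev
    obtain ⟨W, -, hWo, hW⟩ := exists_isOpen_subgroup_subset hev
    refine hG.eq_bot_of_inf_eq_bot hΔ hWo ((Subgroup.eq_bot_iff_forall _).2 fun x hx => ?_)
    have h1 : Commute x (b * m * b⁻¹ * m⁻¹) := hW hx.2 hx.1
    have h2 : x ∈ MulAut.conj (b * m * b⁻¹ * m⁻¹) • Γ ⊓ Γ := by
      refine ⟨?_, hΔΓ hx.1⟩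
      have := conj_smul_mem (g := b * m * b⁻¹ * m⁻¹) (hΔΓ hx.1)
      rwa [← h1.eq, mul_inv_cancel_right] at this
    rwa [hzΓ] at h2
  -- conjugating a local centraliser by an element of the subgroup
  have hconj : ∀ (N : Subgroup G) (n c : G), n ∈ N → (∀ᶠ x in 𝓝 (1 : G), x ∈ N → Commute x c) →
      ∀ᶠ x in 𝓝 (1 : G), x ∈ N → Commute x (n * c * n⁻¹) := by
    intro N n c hn hev
    have ht : Filter.Tendsto (fun v : G => n⁻¹ * v * n) (𝓝 1) (𝓝 1) := by
      have : Continuous (fun v : G => n⁻¹ * v * n) := by fun_prop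
      simpa using this.tendsto 1
    filter_upwards [ht.eventually hev] with x hx hxN
    have h1 := hx (N.mul_mem (N.mul_mem (N.inv_mem hn) hxN) hn)
    have h2 := congrArg (fun y => n * y * n⁻¹) h1.eq
    have h3 : x * (n * c * n⁻¹) = n * c * n⁻¹ * x := by simpa [mul_assoc] using h2
    exact h3
  have evM : ∀ᶠ x in 𝓝 (1 : G), x ∈ M → Commute x b := by
    filter_upwards [hG.eventually_commute hB hM h] with x hx hxM
    exact (hx hxM b hb).symm
  have evB : ∀ᶠ x in 𝓝 (1 : G), x ∈ B → Commute x m := by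
    filter_upwards [hG.eventually_commute hM hB (inf_comm B M ▸ h)] with x hx hxB
    exact (hx hxB m hm).symm
  -- Small elements of `M` commute with `b` and with `m * b * m⁻¹`, hence with the commutator.
  -- Symmetrically for `B`; then `Γ` is disjoint from both and commutes locally with `b` and `m`.
  have hΓM : M ⊓ Γ = ⊥ := by
    refine key _ (hM.inf hΓ) inf_le_right ?_
    filter_upwards [evM, hconj M m b hm evM] with x h1 h2 hx
    have e : b * m * b⁻¹ * m⁻¹ = b * (m * b * m⁻¹)⁻¹ := by group
    rw [e]
    exact (h1 hx.1).mul_right (h2 hx.1).inv_right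
  have hΓB : B ⊓ Γ = ⊥ := by
    refine key _ (hB.inf hΓ) inf_le_right ?_
    filter_upwards [evB, hconj B b m hb evB] with x h1 h2 hx
    exact (h2 hx.1).mul_right (h1 hx.1).inv_right
  refine hΓ1 (key Γ hΓ le_rfl ?_)
  filter_upwards [hG.eventually_commute hB hΓ hΓB, hG.eventually_commute hM hΓ hΓM] with x h1 h2 hx
  have hxb : Commute x b := (h1 hx b hb).symm
  have hxm : Commute x m := (h2 hx m hm).symm
  exact ((hxb.mul_right hxm).mul_right hxb.inv_right).mul_right hxm.inv_right

end IsCompactlyGeneratedSimple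

end Lattice

/-! ### Infinite products of commuting homomorphisms -/

section InfiniteProduct

open Filter

variable {G : Type*} [Group G] {ι D : Type*} [Group D]

theorem pairwise_commute_apply {c : ι → D →* G}
    (hcomm : ∀ i j, i ≠ j → ∀ d d', Commute (c i d) (c j d')) (s : Set ι) (f : ι → D) :
    s.Pairwise (Function.onFun Commute fun i => c i (f i)) :=
  fun i _ j _ hij => hcomm i j hij _ _

/-- The product over a finite set of the values of pairwise commuting homomorphisms. -/
def finiteCommProd (c : ι → D →* G) (hcomm : ∀ i j, i ≠ j → ∀ d d', Commute (c i d) (c j d'))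
    (s : Finset ι) : (ι → D) →* G where
  toFun f := s.noncommProd (fun i => c i (f i)) (pairwise_commute_apply hcomm s f)
  map_one' := by
    rw [Finset.noncommProd_eq_pow_card s _ (pairwise_commute_apply hcomm s 1) 1 (by simp), one_pow]
  map_mul' f g := by
    rw [← Finset.noncommProd_mul_distrib _ _ _ _ fun i _ j _ hij => hcomm i j hij _ _]
    exact Finset.noncommProd_congr rfl (fun i _ => map_mul (c i) _ _)
      (pairwise_commute_apply hcomm s (f * g))

variable {c : ι → D →* G} {hcomm : ∀ i j, i ≠ j → ∀ d d', Commute (c i d) (c j d')}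

theorem finiteCommProd_mem {W : Subgroup G} {s : Finset ι} {f : ι → D}
    (h : ∀ i ∈ s, c i (f i) ∈ W) : finiteCommProd c hcomm s f ∈ W :=
  Subgroup.noncommProd_mem W (pairwise_commute_apply hcomm s f) h

theorem finiteCommProd_sdiff_mul [DecidableEq ι] {s t : Finset ι} (h : s ⊆ t) (f : ι → D) :
    finiteCommProd c hcomm t f =
      finiteCommProd c hcomm s f * finiteCommProd c hcomm (t \ s) f := by
  have := Finset.noncommProd_union_of_disjoint (Finset.disjoint_sdiff (s := s) (t := t))
    (fun i => c i (f i)) (pairwise_commute_apply hcomm _ f)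
  refine Eq.trans ?_ this
  exact Finset.noncommProd_congr (Finset.union_sdiff_of_subset h).symm (fun _ _ => rfl)
    (pairwise_commute_apply hcomm _ f)

theorem finiteCommProd_mulSingle [DecidableEq ι] {s : Finset ι} {i : ι} (hi : i ∈ s) (d : D) :
    finiteCommProd c hcomm s (Pi.mulSingle i d) = c i d := by
  have h1 : finiteCommProd c hcomm (s \ {i}) (Pi.mulSingle i d) = 1 := by
    rw [← Subgroup.mem_bot]
    refine finiteCommProd_mem fun j hj => ?_
    have : j ≠ i := by simpa using (Finset.mem_sdiff.1 hj).2
    simp [Pi.mulSingle_eq_of_ne this]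
  have h2 : finiteCommProd c hcomm {i} (Pi.mulSingle i d) = c i d := by
    refine (Finset.noncommProd_singleton i fun j =>
      c j (Pi.mulSingle (M := fun _ => D) i d j)).trans ?_
    rw [Pi.mulSingle_eq_same]
  rw [finiteCommProd_sdiff_mul (Finset.singleton_subset_iff.2 hi), h1, h2, mul_one]

/-- Continuous homomorphisms on a product are determined by their restrictions to the factors. -/
theorem monoidHom_pi_ext [DecidableEq ι] [TopologicalSpace G] [T2Space G]
    [TopologicalSpace D] {φ ψ : (ι → D) →* G}
    (hφ : Continuous φ) (hψ : Continuous ψ)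
    (h : ∀ i d, φ (Pi.mulSingle i d) = ψ (Pi.mulSingle i d)) : φ = ψ := by
  ext f
  let r : Finset ι → ι → D := fun s i => if i ∈ s then f i else 1
  have hr : Tendsto r atTop (𝓝 f) := by
    refine tendsto_pi_nhds.2 fun i => tendsto_const_nhds.congr' ?_
    filter_upwards [eventually_ge_atTop {i}] with s hs
    simp [r, hs (Finset.mem_singleton_self i)]
  have he : ∀ s, φ (r s) = ψ (r s) := by
    intro s
    induction s using Finset.induction_on with
    | empty =>
      have : r ∅ = 1 := by ext i; simp [r]
      rw [this, map_one, map_one]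
    | insert a s ha ih =>
      have : r (insert a s) = Pi.mulSingle a (f a) * r s := by
        ext i
        by_cases hi : i = a
        · subst hi; simp [r, ha]
        · simp [r, hi]
      rw [this, map_mul, map_mul, ih, h]
  exact tendsto_nhds_unique ((hφ.tendsto f).comp hr)
    (((hψ.tendsto f).comp hr).congr fun s => (he s).symm)

variable [TopologicalSpace G] [IsTopologicalGroup G] [T2Space G] [LocallyCompactSpace G]
  [TotallyDisconnectedSpace G]

/-- Compactness of `U` supplies a cluster point. Beyond the finitely many indices whose images leave
`V`, the finite products agree modulo `V`, so the cluster point is a limit. -/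
theorem exists_tendsto_finiteCommProd (hcomm) {U : Subgroup G} (hU : IsCompact (U : Set G))
    (hcU : ∀ i d, c i d ∈ U)
    (hlim : ∀ V : Subgroup G, IsOpen (V : Set G) → {i | ¬ ∀ d, c i d ∈ V}.Finite) (f : ι → D) :
    ∃ x, Tendsto (fun s => finiteCommProd c hcomm s f) atTop (𝓝 x) := by
  classical
  obtain ⟨x, -, hx⟩ := hU.exists_mapClusterPt (f := atTop)
    (u := fun s : Finset ι => finiteCommProd c hcomm s f)
    (by simpa using ⟨∅, fun s _ => finiteCommProd_mem fun i _ => hcU i _⟩)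
  refine ⟨x, fun O hO => ?_⟩
  have hO' : (fun g => x * g) ⁻¹' O ∈ 𝓝 (1 : G) :=
    (continuous_const_mul x).continuousAt.preimage_mem_nhds (by simpa using hO)
  obtain ⟨V, -, hVo, hV⟩ := exists_isOpen_subgroup_subset hO'
  have hxV : {y | x⁻¹ * y ∈ V} ∈ 𝓝 x :=
    (hVo.preimage (continuous_const_mul x⁻¹)).mem_nhds (by simp)
  set s₀ := (hlim V hVo).toFinset with hs₀
  have key : ∀ s, s₀ ⊆ s →
      (finiteCommProd c hcomm s₀ f)⁻¹ * finiteCommProd c hcomm s f ∈ V := fun s hs => by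
    rw [finiteCommProd_sdiff_mul hs, inv_mul_cancel_left]
    refine finiteCommProd_mem fun i hi => ?_
    have := (Finset.mem_sdiff.1 hi).2
    rw [hs₀, Set.Finite.mem_toFinset, Set.mem_ofPred_eq, not_not] at this
    exact this _
  obtain ⟨s₁, h1, h2⟩ := ((mapClusterPt_iff_frequently.1 hx _ hxV).and_eventually
    (eventually_ge_atTop s₀)).exists
  rw [mem_map]
  filter_upwards [eventually_ge_atTop s₀] with s hs
  have := V.mul_mem (V.mul_mem h1 (V.inv_mem (key s₁ h2))) (key s hs)
  have h3 : x⁻¹ * finiteCommProd c hcomm s f ∈ V := by simpa [mul_assoc] using this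
  simpa using hV h3

/-- Infinite products of pairwise commuting homomorphisms that converge to `1`. -/
theorem exists_infiniteCommProd [DecidableEq ι] [TopologicalSpace D] [IsTopologicalGroup D]
    (hcont : ∀ i, Continuous (c i))
    (hcomm : ∀ i j, i ≠ j → ∀ d d', Commute (c i d) (c j d')) {U : Subgroup G}
    (hU : IsCompact (U : Set G)) (hcU : ∀ i d, c i d ∈ U)
    (hlim : ∀ V : Subgroup G, IsOpen (V : Set G) → {i | ¬ ∀ d, c i d ∈ V}.Finite) :
    ∃ Φ : (ι → D) →* G, Continuous Φ ∧ (∀ i d, Φ (Pi.mulSingle i d) = c i d) ∧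
      ∀ (W : Subgroup G) (f : ι → D), IsClosed (W : Set G) → (∀ i, c i (f i) ∈ W) → Φ f ∈ W := by
  choose φ hφ using exists_tendsto_finiteCommProd hcomm hU hcU hlim
  let Φ : (ι → D) →* G :=
    { toFun := φ
      map_one' := tendsto_nhds_unique (hφ 1) (by simp)
      map_mul' := fun f g => tendsto_nhds_unique (hφ (f * g)) (by
        simp only [map_mul]
        exact (hφ f).mul (hφ g)) }
  -- This clause later carries normalising and centralising conditions from the factors to infinite
  -- products.
  have hmem : ∀ (W : Subgroup G) (f : ι → D), IsClosed (W : Set G) → (∀ i, c i (f i) ∈ W) →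
      Φ f ∈ W := fun W f hW h =>
    hW.mem_of_tendsto (hφ f) (Eventually.of_forall fun s => finiteCommProd_mem fun i _ => h i)
  refine ⟨Φ, ?_, fun i d => ?_, hmem⟩
  · refine continuous_of_continuousAt_one Φ fun O hO => ?_
    rw [map_one] at hO
    obtain ⟨V, -, hVo, hV⟩ := exists_isOpen_subgroup_subset hO
    have h1 : ∀ᶠ f in 𝓝 (1 : ι → D), ∀ i ∈ {i | ¬ ∀ d, c i d ∈ V}, c i (f i) ∈ V := by
      refine (eventually_all_finite (hlim V hVo)).2 fun i _ => ?_
      have ht : Tendsto (fun f : ι → D => c i (f i)) (𝓝 1) (𝓝 1) := by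
        have : Continuous (fun f : ι → D => c i (f i)) := (hcont i).comp (continuous_apply i)
        simpa using this.tendsto 1
      exact ht (hVo.mem_nhds V.one_mem)
    rw [mem_map]
    filter_upwards [h1] with f hf
    refine hV (hmem V f (Subgroup.isClosed_of_isOpen _ hVo) fun i => ?_)
    by_cases hi : ∀ d, c i d ∈ V
    · exact hi _
    · exact hf i hi
  · refine tendsto_nhds_unique (hφ _) (tendsto_const_nhds.congr' ?_)
    filter_upwards [eventually_ge_atTop {i}] with s hs
    exact (finiteCommProd_mulSingle (hs (Finset.mem_singleton_self i)) d).symm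

end InfiniteProduct

/-! ### Construction of the wreath product -/

section Wreath

variable {G : Type*} [Group G] [TopologicalSpace G] [IsTopologicalGroup G] [T2Space G]
  [LocallyCompactSpace G] [TotallyDisconnectedSpace G]

namespace IsCompactlyGeneratedSimple

/-- A wandering locally normal subgroup contains one whose translates converge to `1` in both
directions. -/
theorem exists_contracting (hG : IsCompactlyGeneratedSimple G)
    (hfaith : ∀ y : G, y ≠ 1 →
      ∃ Γ : Subgroup G, IsLocallyNormal Γ ∧ Γ ≠ ⊥ ∧ MulAut.conj y • Γ ⊓ Γ = ⊥) :
    ∃ (t : G) (K U : Subgroup G), IsLocallyNormal K ∧ K ≠ ⊥ ∧ IsCompact (U : Set G) ∧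
      (∀ i j : ℤ, i ≠ j → MulAut.conj (t ^ i) • K ⊓ MulAut.conj (t ^ j) • K = ⊥) ∧
      (∀ i : ℤ, MulAut.conj (t ^ i) • K ≤ U) ∧
      ∀ V : Subgroup G, IsOpen (V : Set G) → {i : ℤ | ¬ MulAut.conj (t ^ i) • K ≤ V}.Finite := by
  obtain ⟨t, L, hL, hL1, hdisj⟩ := hG.exists_wandering hfaith
  obtain ⟨U, hUc, hUo⟩ := exists_isCompact_isOpen_subgroup G
  have hfin := fun (V : Subgroup G) (hV : IsOpen (V : Set G)) =>
    hG.finite_setOf_not_le hfaith (fun i : ℤ => hL.conj (t ^ i)) hdisj hUc hV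
  have hbad := hfin (MulAut.conj t⁻¹ • U ⊓ MulAut.conj t • U)
    ((isOpen_conj_smul hUo _).inter (isOpen_conj_smul hUo _))
  -- From exponent `N` outwards, a translate inside `U` stays in `U` after one more step by `t` or
  -- `t⁻¹`. The subgroup `P` below supplies the finitely many exponents in between.
  obtain ⟨N, hN⟩ : ∃ N : ℕ, ∀ i : ℤ, N ≤ i.natAbs → MulAut.conj (t ^ i) • L ⊓ U ≤
      MulAut.conj t⁻¹ • U ⊓ MulAut.conj t • U := by
    obtain ⟨N, hN⟩ := (hbad.image Int.natAbs).bddAbove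
    refine ⟨N + 1, fun i hi => ?_⟩
    by_contra hcon
    have := hN ⟨i, hcon, rfl⟩
    omega
  have hev : ∀ᶠ x in 𝓝 (1 : G), ∀ i ∈ Set.Icc (-(N : ℤ)) N, t ^ i * x * (t ^ i)⁻¹ ∈ U := by
    refine (Filter.eventually_all_finite (Set.finite_Icc _ _)).2 fun i _ => ?_
    have ht : Filter.Tendsto (fun x : G => t ^ i * x * (t ^ i)⁻¹) (𝓝 1) (𝓝 1) := by
      have : Continuous (fun x : G => t ^ i * x * (t ^ i)⁻¹) := by fun_prop
      simpa using this.tendsto 1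
    exact ht (hUo.mem_nhds U.one_mem)
  obtain ⟨P, -, hPo, hP⟩ := exists_isOpen_subgroup_subset hev
  have hmem : ∀ x ∈ L ⊓ P, ∀ i : ℤ, t ^ i * x * (t ^ i)⁻¹ ∈ U := by
    intro x hx
    have hpos : ∀ i : ℤ, (N : ℤ) ≤ i → t ^ i * x * (t ^ i)⁻¹ ∈ U := by
      intro i hi
      induction i, hi using Int.leInduction with
      | base => exact hP hx.2 _ ⟨by omega, le_rfl⟩
      | succ i hi ih =>
        have h1 := (Subgroup.mem_inf.1 (hN i (by omega) ⟨conj_smul_mem hx.1, ih⟩)).1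
        rw [mem_conj_smul, inv_inv] at h1
        rw [add_comm, zpow_add, zpow_one]
        simpa [mul_assoc] using h1
    have hneg : ∀ i : ℤ, i ≤ -(N : ℤ) → t ^ i * x * (t ^ i)⁻¹ ∈ U := by
      intro i hi
      induction i, hi using Int.leInductionDown with
      | base => exact hP hx.2 _ ⟨le_rfl, by omega⟩
      | pred i hi ih =>
        have h1 := (Subgroup.mem_inf.1 (hN i (by omega) ⟨conj_smul_mem hx.1, ih⟩)).2
        rw [mem_conj_smul] at h1
        rw [sub_eq_add_neg, add_comm, zpow_add, zpow_neg_one]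
        simpa [mul_assoc] using h1
    intro i
    by_cases h1 : (N : ℤ) ≤ i
    · exact hpos i h1
    by_cases h2 : i ≤ -(N : ℤ)
    · exact hneg i h2
    · exact hP hx.2 i ⟨by omega, by omega⟩
  have hle : ∀ i : ℤ, MulAut.conj (t ^ i) • (L ⊓ P) ≤ U := by
    intro i x hx
    have := hmem _ (mem_conj_smul.1 hx) i
    simpa [mul_assoc] using this
  have hleL : ∀ i : ℤ, MulAut.conj (t ^ i) • (L ⊓ P) ≤ MulAut.conj (t ^ i) • L := fun i =>
    Subgroup.smul_inf (MulAut.conj (t ^ i)) L P ▸ inf_le_left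
  refine ⟨t, L ⊓ P, U, hL.inf_of_isOpen hPo, fun h => hL1 (hG.eq_bot_of_inf_eq_bot hL hPo h), hUc,
    fun i j hij => ?_, hle, fun V hV => (hfin V hV).subset fun i hi hcon => hi ?_⟩
  · exact eq_bot_iff.2 ((inf_le_inf (hleL i) (hleL j)).trans (hdisj i j hij).le)
  · exact (le_inf (hleL i) (hle i)).trans hcon

/-- A wandering locally normal subgroup yields an unrestricted wreath product. -/
theorem exists_wreathProduct (hG : IsCompactlyGeneratedSimple G)
    (hfaith : ∀ y : G, y ≠ 1 →
      ∃ Γ : Subgroup G, IsLocallyNormal Γ ∧ Γ ≠ ⊥ ∧ MulAut.conj y • Γ ⊓ Γ = ⊥) :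
    ∃ K : Subgroup G, IsLocallyNormal K ∧ K ≠ ⊥ ∧
      ∃ H : Subgroup G, IsClosed (H : Set G) ∧
        ∃ e : UnrestrictedWreathProductInt K ≃ₜ* H,
          ∀ k : K, (e (UnrestrictedWreathProductInt.baseFactor k) : G) = (k : G) := by
  obtain ⟨t, K, U, hK, hK1, hU, hdisj, hKU, hlim⟩ := hG.exists_contracting hfaith
  have : CompactSpace K := isCompact_iff_compactSpace.1 hK.1
  let τ : Multiplicative ℤ →* G := zpowersHom G t
  have hdisj' : ∀ p q : Multiplicative ℤ, p ≠ q →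
      MulAut.conj (τ p) • K ⊓ MulAut.conj (τ q) • K = ⊥ := fun p q hpq =>
    hdisj p.toAdd q.toAdd hpq
  let c : Multiplicative ℤ → K →* G := fun q => (MulAut.conj (τ q)).toMonoidHom.comp K.subtype
  have hc : ∀ q k, c q k = τ q * k * (τ q)⁻¹ := fun q k => rfl
  have hcK : ∀ q k, c q k ∈ MulAut.conj (τ q) • K := fun q k => conj_smul_mem k.2
  have hcomm : ∀ p q, p ≠ q → ∀ k l, Commute (c p k) (c q l) := fun p q hpq k l =>
    hG.mul_comm_of_inf_eq_bot hfaith (hK.conj _) (hK.conj _) (hdisj' p q hpq) (hcK p k) (hcK q l)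
  have hccont : ∀ q, Continuous (c q) := fun q => by
    change Continuous fun k : K => τ q * k * (τ q)⁻¹
    fun_prop
  obtain ⟨Φ, hΦ, hΦs, hΦW⟩ := exists_infiniteCommProd hccont hcomm hU
    (fun q k => hKU q.toAdd (hcK q k)) fun V hV =>
      ((hlim V hV).preimage (f := Multiplicative.toAdd)
        Multiplicative.toAdd.injective.injOn).subset fun q hq hcon => hq fun k => hcon (hcK q k)
  -- conjugation by `t` acts as the shift
  let shift : Multiplicative ℤ → (Multiplicative ℤ → K) →* (Multiplicative ℤ → K) := fun q =>
    { toFun := fun f x => f (q⁻¹ * x)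
      map_one' := rfl
      map_mul' := fun _ _ => rfl }
  have hshift : ∀ q f, τ q * Φ f * (τ q)⁻¹ = Φ (shift q f) := by
    intro q f
    have h1 : Continuous ((MulAut.conj (τ q)).toMonoidHom.comp Φ) := by
      change Continuous fun f => τ q * Φ f * (τ q)⁻¹
      fun_prop
    have h2 : Continuous (Φ.comp (shift q)) :=
      hΦ.comp (continuous_pi fun x => continuous_apply (q⁻¹ * x))
    have h3 := monoidHom_pi_ext h1 h2 fun i k => by
      have e : shift q (Pi.mulSingle i k) = Pi.mulSingle (q * i) k := by
        ext x
        change ((Pi.mulSingle i k : Multiplicative ℤ → K) (q⁻¹ * x) : G) = _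
        by_cases hx : x = q * i
        · subst hx; simp
        · have : q⁻¹ * x ≠ i := fun h => hx (by rw [← h, mul_inv_cancel_left])
          rw [Pi.mulSingle_eq_of_ne this, Pi.mulSingle_eq_of_ne hx]
      change τ q * Φ (Pi.mulSingle i k) * (τ q)⁻¹ = Φ (shift q (Pi.mulSingle i k))
      rw [e, hΦs, hΦs, hc, hc, map_mul]
      group
    exact DFunLike.congr_fun h3 f
  -- `N_G(K)` separates the base group from the other cosets
  have hΦN : ∀ f, Φ f ∈ Subgroup.normalizer (K : Set G) := by
    refine fun f => hΦW _ f (Subgroup.isClosed_of_isOpen _ hK.2) fun q => ?_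
    by_cases hq : q = 1
    · subst hq
      have := hcK 1 (f 1)
      rw [map_one, map_one, one_smul] at this
      exact Subgroup.le_normalizer this
    · refine Subgroup.centralizer_le_normalizer _ (Subgroup.mem_centralizer_iff.2 fun x hx => ?_)
      have := (hcomm q 1 hq (f q) ⟨x, hx⟩).eq.symm
      simpa [hc 1] using this
  have hτN : ∀ q, τ q ∈ Subgroup.normalizer (K : Set G) → q = 1 := by
    intro q hq
    by_contra hq1
    have := hdisj' q 1 hq1
    rw [conj_smul_eq_self_of_mem_normalizer hq, map_one, map_one, one_smul, inf_idem] at this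
    exact hK1 this
  -- The factor at `q` is the inverse of a product of the other factors, which commute with it. So
  -- `f q` is central in `K`, and the centre of `K` is trivial.
  have hcinj : ∀ f, Φ f = 1 → f = 1 := by
    intro f hf
    ext q
    have hfac : f = Pi.mulSingle q (f q) * Function.update f q 1 := by
      ext x
      by_cases hx : x = q
      · subst hx; simp
      · simp [hx]
    have h1 : ∀ k, Commute (c q k) (Φ (Function.update f q 1)) := by
      intro k
      have : Φ (Function.update f q 1) ∈ Subgroup.centralizer {c q k} := by
        refine hΦW _ _ (Set.isClosed_centralizer _) fun p => ?_
        rw [Subgroup.mem_centralizer_singleton_iff]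
        by_cases hp : p = q
        · subst hp; simp
        · exact (hcomm p q hp _ _).eq
      exact (Subgroup.mem_centralizer_singleton_iff.1 this).symm
    rw [hfac, map_mul, hΦs, mul_eq_one_iff_eq_inv] at hf
    have h2 : ∀ k : K, Commute (k : G) (f q) := by
      intro k
      have h3 : Commute (c q k) (c q (f q)) := hf ▸ (h1 k).inv_right
      rw [hc, hc] at h3
      have h4 := congrArg (fun y => (τ q)⁻¹ * y * τ q) h3.eq
      have h5 : (k : G) * f q = f q * k := by simpa [mul_assoc] using h4
      exact h5
    have h3 : ((f q : K) : G) ∈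
        K ⊓ Subgroup.centralizer ((K ⊓ (⊤ : Subgroup G) : Subgroup G) : Set G) :=
      ⟨(f q).2, Subgroup.mem_centralizer_iff.2 fun k hk => (h2 ⟨k, hk.1⟩).eq⟩
    rw [hG.inf_centralizer_eq_bot hK isOpen_univ] at h3
    simpa using h3
  let E : UnrestrictedWreathProductInt K →* G :=
    { toFun := fun w => Φ w.left * τ w.right
      map_one' := by simp
      map_mul' := fun a b => by
        have h1 : (a * b).left = a.left * shift a.right b.left := rfl
        rw [h1, RegularWreathProduct.mul_right, map_mul, map_mul, ← hshift]
        group }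
  have hEinj : Function.Injective E := by
    refine (injective_iff_map_eq_one E).2 fun w hw => ?_
    have hw' : Φ w.left * τ w.right = 1 := hw
    have h1 : w.right = 1 := by
      refine hτN _ ?_
      rw [← inv_eq_of_mul_eq_one_right hw']
      exact Subgroup.inv_mem _ (hΦN _)
    rw [h1, map_one, mul_one] at hw'
    exact RegularWreathProduct.ext (hcinj _ hw') h1
  have hclosed : Topology.IsClosedEmbedding fun p : (Multiplicative ℤ → K) × Multiplicative ℤ =>
      Φ p.1 * τ p.2 := by
    refine .of_continuous_injective_isClosedMap ?_ ?_ ?_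
    · exact (hΦ.comp continuous_fst).mul
        ((continuous_of_discreteTopology (f := τ)).comp continuous_snd)
    · exact hEinj.comp (RegularWreathProduct.equivProd K (Multiplicative ℤ)).symm.injective
    · intro C hC
      have himage : (fun p : (Multiplicative ℤ → K) × Multiplicative ℤ => Φ p.1 * τ p.2) '' C =
          ⋃ q : Multiplicative ℤ, (fun f => Φ f * τ q) '' {f | (f, q) ∈ C} := by
        ext x
        simp only [Set.mem_image, Set.mem_iUnion, Prod.exists, Set.mem_ofPred_eq]
        exact ⟨fun ⟨f, q, h⟩ => ⟨q, f, h⟩, fun ⟨q, f, h⟩ => ⟨f, q, h⟩⟩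
      rw [himage]
      -- Each left coset of the open subgroup `N_G(K)` meets the slice of at most one `q`, and every
      -- slice is compact.
      refine LocallyFinite.isClosed_iUnion ?_ fun q => ?_
      · intro x
        refine ⟨(fun y => x⁻¹ * y) ⁻¹' (Subgroup.normalizer (K : Set G) : Set G),
          (hK.2.preimage (by fun_prop)).mem_nhds (by simp), Set.Subsingleton.finite ?_⟩
        rintro q ⟨_, ⟨f, -, rfl⟩, hf⟩ q' ⟨_, ⟨f', -, rfl⟩, hf'⟩
        have h1 : (x⁻¹ * (Φ f * τ q))⁻¹ * (x⁻¹ * (Φ f' * τ q')) ∈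
          Subgroup.normalizer (K : Set G) := Subgroup.mul_mem _ (Subgroup.inv_mem _ hf) hf'
        have h2 : (x⁻¹ * (Φ f * τ q))⁻¹ * (x⁻¹ * (Φ f' * τ q')) =
            Φ (shift q⁻¹ (f⁻¹ * f')) * τ (q⁻¹ * q') := by
          rw [← hshift, map_mul, map_mul, map_inv, map_inv]
          group
        rw [h2, Subgroup.mul_mem_cancel_left _ (hΦN _)] at h1
        exact inv_mul_eq_one.1 (hτN _ h1)
      · have hCq : IsClosed {f : Multiplicative ℤ → K | (f, q) ∈ C} :=
          hC.preimage (by fun_prop)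
        exact (hCq.isCompact.image (by fun_prop)).isClosed
  have hE : Topology.IsClosedEmbedding E := by
    have h1 : Topology.IsClosedEmbedding (RegularWreathProduct.equivProd K (Multiplicative ℤ)) :=
      ((RegularWreathProduct.equivProd K (Multiplicative ℤ)).toHomeomorphOfIsInducing
        ⟨rfl⟩).isClosedEmbedding
    exact hclosed.comp h1
  refine ⟨K, hK, hK1, E.range, by simpa using hE.isClosed_range,
    { MonoidHom.ofInjective hEinj with
      continuous_toFun := hE.continuous.subtype_mk _
      continuous_invFun := ?_ }, fun k => ?_⟩
  · refine hE.isEmbedding.continuous_iff.2 ?_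
    refine continuous_subtype_val.congr fun x => ?_
    exact congrArg Subtype.val ((MonoidHom.ofInjective hEinj).apply_symm_apply x).symm
  · change Φ (Pi.mulSingle (Multiplicative.ofAdd 0) k) * τ 1 = k
    rw [hΦs, hc, ofAdd_zero, map_one]
    simp

end IsCompactlyGeneratedSimple

end Wreath

/-! ### Disjoint subgroups and nontriviality of the lattice -/

section Main

variable {G : Type*} [Group G] [TopologicalSpace G] [IsTopologicalGroup G] [T2Space G]
  [LocallyCompactSpace G] [TotallyDisconnectedSpace G]

namespace IsCompactlyGeneratedSimple

/-- If a nontrivial locally normal subgroup commutes with a conjugate of itself then the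
centraliser lattice is nontrivial. -/
theorem centraliserLattice_ne (hG : IsCompactlyGeneratedSimple G) {K : Subgroup G}
    (hK : IsLocallyNormal K) (hK1 : K ≠ ⊥) {t : G}
    (ht : ∀ k ∈ K, ∀ l ∈ K, k * (t * l * t⁻¹) = t * l * t⁻¹ * k) :
    centraliserLattice G ≠ {0, StructureLattice.infty G} := by
  intro hLC
  obtain ⟨U, hUc, hUo, hU⟩ := exists_isOpen_subgroup_subset (hK.2.mem_nhds (Subgroup.one_mem _))
  have hn : U ≤ Subgroup.normalizer ((K ⊓ U : Subgroup G) : Set G) :=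
    le_normalizer_of_conj_mem fun u hu x hx => ⟨conj_mem_of_le_normalizer le_rfl (hU hu) hx.1,
      U.mul_mem (U.mul_mem hu hx.2) (U.inv_mem hu)⟩
  have hmem : StructureLattice.mk _ (isLocallyNormal_centralizer_inf hUc hUo hn) ∈
      centraliserLattice G :=
    ⟨StructureLattice.mk (K ⊓ U) (hK.inf_of_isOpen hUo), K ⊓ U, U, hK.inf_of_isOpen hUo, hUc, hUo,
      inf_le_right, hn, rfl, rfl⟩
  rw [hLC] at hmem
  rcases hmem with h | h
  -- Class `0` makes the centraliser `C` finite, but it contains the conjugate of `K` by `t`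
  -- intersected with `U`. A small `W` then meets that conjugate trivially inside `U`.
  · have h1 := ((StructureLattice.mk_eq_mk_iff _ isLocallyNormal_bot).1 h).2
    rw [Subgroup.relIndex_bot_left, Nat.card_ne_zero] at h1
    set C := Subgroup.centralizer ((K ⊓ U : Subgroup G) : Set G) ⊓ U with hC
    have hfin : (C : Set G).Finite := Set.finite_coe_iff.1 h1.2
    obtain ⟨W, -, hWo, hW⟩ := exists_isOpen_subgroup_subset
      ((hfin.subset (Set.sdiff_subset (t := {1}))).isClosed.isOpen_compl.mem_nhds
        (show (1 : G) ∈ ((C : Set G) \ {1})ᶜ by simp))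
    have h2 : MulAut.conj t • K ⊓ (U ⊓ W) = ⊥ := by
      refine (Subgroup.eq_bot_iff_forall _).2 fun x hx => ?_
      by_contra hx1
      refine hW hx.2.2 ⟨⟨Subgroup.mem_centralizer_iff.2 fun k hk => ?_, hx.2.1⟩, hx1⟩
      have := ht k hk.1 _ (mem_conj_smul.1 hx.1)
      simpa [mul_assoc] using this
    exact hK1 (conj_smul_eq_bot_iff.1 (hG.eq_bot_of_inf_eq_bot (hK.conj t) (hUo.inter hWo) h2))
  -- Class `∞` makes `C` closed of finite index in `U`, hence open, so elements of `K ⊓ U` are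
  -- quasi-central.
  · rw [Set.mem_singleton_iff, ← StructureLattice.mk_eq_infty hUc hUo] at h
    have h1 := ((StructureLattice.mk_eq_mk_iff _ _).1 h).1
    set C := Subgroup.centralizer ((K ⊓ U : Subgroup G) : Set G) ⊓ U with hC
    have hCo : IsOpen (C : Set G) := by
      have hCc : IsClosed (C.subgroupOf U : Set U) :=
        ((Set.isClosed_centralizer _).inter hUc.isClosed).preimage continuous_subtype_val
      have : (C.subgroupOf U).FiniteIndex := ⟨h1⟩
      have h2 := Subgroup.isOpen_of_isClosed_of_finiteIndex _ hCc
      have h3 := hUo.isOpenMap_subtype_val _ h2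
      rw [← Subgroup.coe_subtype, ← Subgroup.coe_map, Subgroup.map_subgroupOf_eq_of_le
        inf_le_right] at h3
      exact h3
    refine hK1 (hG.eq_bot_of_inf_eq_bot hK hUo ((Subgroup.eq_bot_iff_forall _).2 fun x hx => ?_))
    refine hG.eq_one_of_isOpen_centralizer ?_
    filter_upwards [hCo.mem_nhds C.one_mem] with u hu
    exact (Subgroup.mem_centralizer_iff.1 hu.1 x hx).symm

theorem zero_mem_centraliserLattice (hG : IsCompactlyGeneratedSimple G) :
    (0 : StructureLattice G) ∈ centraliserLattice G := by
  obtain ⟨U, hUc, hUo⟩ := exists_isCompact_isOpen_subgroup G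
  refine ⟨_, U, U, isLocallyNormal_of_isCompact_of_isOpen hUc hUo, hUc, hUo, le_rfl,
    Subgroup.le_normalizer, rfl, ?_⟩
  refine (StructureLattice.mk_eq_mk_iff isLocallyNormal_bot _).2 ?_
  have : Subgroup.centralizer (U : Set G) ⊓ U = ⊥ := by
    refine (Subgroup.eq_bot_iff_forall _).2 fun x hx => hG.eq_one_of_isOpen_centralizer ?_
    filter_upwards [hUo.mem_nhds U.one_mem] with u hu
    exact Subgroup.mem_centralizer_iff.1 hx.1 u hu
  rw [this]

theorem infty_mem_centraliserLattice :
    StructureLattice.infty G ∈ centraliserLattice G := by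
  obtain ⟨U, hUc, hUo⟩ := exists_isCompact_isOpen_subgroup G
  have hn : U ≤ Subgroup.normalizer ((⊥ : Subgroup G) : Set G) :=
    le_normalizer_of_conj_mem fun u _ x hx => by simp [Subgroup.mem_bot.1 hx]
  refine ⟨_, ⊥, U, isLocallyNormal_bot, hUc, hUo, bot_le, hn, rfl, ?_⟩
  rw [← StructureLattice.mk_eq_infty hUc hUo, StructureLattice.mk_eq_mk_iff]
  have : Subgroup.centralizer ((⊥ : Subgroup G) : Set G) ⊓ U = U :=
    inf_eq_right.2 fun x _ => Subgroup.mem_centralizer_iff.2 fun b hb => by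
      simp [Subgroup.mem_bot.1 hb]
  rw [this]

/-- A nontrivial centraliser lattice yields two disjoint nontrivial locally normal subgroups. -/
theorem exists_disjoint_of_centraliserLattice_ne (hG : IsCompactlyGeneratedSimple G)
    (h : centraliserLattice G ≠ {0, StructureLattice.infty G}) :
    ∃ K M : Subgroup G, IsLocallyNormal K ∧ IsLocallyNormal M ∧ K ≠ ⊥ ∧ M ≠ ⊥ ∧ M ⊓ K = ⊥ := by
  have hsub : ({0, StructureLattice.infty G} : Set (StructureLattice G)) ⊆ centraliserLattice G :=
    Set.insert_subset_iff.2 ⟨hG.zero_mem_centraliserLattice,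
      Set.singleton_subset_iff.2 infty_mem_centraliserLattice⟩
  obtain ⟨β, ⟨α, K, U, hK, hUc, hUo, hKU, hn, -, rfl⟩, hβ⟩ :=
    Set.exists_of_ssubset (hsub.ssubset_of_ne h.symm)
  have hM := isLocallyNormal_centralizer_inf hUc hUo hn
  refine ⟨K, _, hK, hM, ?_, ?_, ?_⟩
  · rintro rfl
    refine hβ (Or.inr ?_)
    rw [Set.mem_singleton_iff, ← StructureLattice.mk_eq_infty hUc hUo,
      StructureLattice.mk_eq_mk_iff]
    have : Subgroup.centralizer ((⊥ : Subgroup G) : Set G) ⊓ U = U :=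
      inf_eq_right.2 fun x _ => Subgroup.mem_centralizer_iff.2 fun b hb => by
        simp [Subgroup.mem_bot.1 hb]
    rw [this]
  · intro hbot
    refine hβ (Or.inl ((StructureLattice.mk_eq_mk_iff _ isLocallyNormal_bot).2 ?_))
    rw [hbot]
  · rw [eq_bot_iff, ← hG.inf_centralizer_eq_bot hK (P := ⊤) isOpen_univ, inf_top_eq]
    exact fun x hx => ⟨hx.2, hx.1.1⟩

end IsCompactlyGeneratedSimple

end Main

theorem mainTheorem9 (G : Type*) [Group G] [TopologicalSpace G] [IsTopologicalGroup G]
    [T2Space G] [LocallyCompactSpace G] [TotallyDisconnectedSpace G]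
    (hgen : IsCompactlyGeneratedGroup G) (hsimple : IsTopologicallySimpleGroup G)
    (hnondiscrete : ¬ DiscreteTopology G) :
    centraliserLattice G ≠ {0, StructureLattice.infty G} ↔
      ∃ K : Subgroup G, IsLocallyNormal K ∧ K ≠ ⊥ ∧
        ∃ H : Subgroup G, IsClosed (H : Set G) ∧
          ∃ e : UnrestrictedWreathProductInt K ≃ₜ* H,
            ∀ k : K, (e (UnrestrictedWreathProductInt.baseFactor k) : G) = (k : G) := by
  have hG : IsCompactlyGeneratedSimple G := ⟨hgen, hsimple, hnondiscrete⟩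
  constructor
  · intro h
    obtain ⟨K, M, hK, hM, hK1, hM1, hMK⟩ := hG.exists_disjoint_of_centraliserLattice_ne h
    exact hG.exists_wreathProduct fun y hy => hG.exists_conj_smul_inf_eq_bot hK hM hK1 hM1 hMK hy
  · rintro ⟨K, hK, hK1, H, -, e, he⟩
    -- The shift moves the factor of index `0` to a different index, so the factor commutes with its
    -- conjugate by `s`.
    let s : UnrestrictedWreathProductInt K := RegularWreathProduct.inl (Multiplicative.ofAdd 1)
    refine hG.centraliserLattice_ne hK hK1 (t := (e s : G)) fun k hk l hl => ?_
    have key : UnrestrictedWreathProductInt.baseFactor ⟨k, hk⟩ *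
        (s * UnrestrictedWreathProductInt.baseFactor ⟨l, hl⟩ * s⁻¹) =
        s * UnrestrictedWreathProductInt.baseFactor ⟨l, hl⟩ * s⁻¹ *
          UnrestrictedWreathProductInt.baseFactor ⟨k, hk⟩ := by
      ext x
      · by_cases hx : x = 1
        · subst hx
          simp [s, UnrestrictedWreathProductInt.baseFactor]
        · simp [s, UnrestrictedWreathProductInt.baseFactor, Pi.mulSingle_eq_of_ne hx]
      · simp [s, UnrestrictedWreathProductInt.baseFactor]
    have h1 := congrArg (fun w => ((e w : H) : G)) key
    simpa [map_mul, map_inv, he] using h1
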